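/- All manifolds and foliations are smooth. A *leafwise complex foliation* $(\mathcal F,J)$ of a 3-manifold $M$ (codimension one, leaves of complex dimension one) is an atlas of charts with values in $\mathbb C\times\mathbb R\ni(z,x)$ whose coordinate changes $(z,x)\mapsto(w,t)$ are smooth, with $t$ locally depending only on $x$ and $w$ holomorphic in $z$ for fixed $x$; if $M$ has boundary and is foliated tangentially to it, $\mathbb R$ is replaced by $[0,\infty)$. Isomorphisms are the diffeomorphisms that preserve the foliations and are biholomorphic on leaves, and $\mathrm{Aut}(M,\mathcal F,J)$ is the group of automorphisms. *Reeb components.* For $\lambda\in\mathbb C$ with $|\lambda|>1$ and $\varphi\in\mathrm{Diff}^\infty([0,\infty))$ with $\varphi(x)>x$ for $x>0$, let $R_{\varphi,\lambda}=\big(\mathbb C\times[0,\infty)\setminus\{(0,0)\}\big)/T^{\mathbb Z}$, $T(z,x)=(\lambda z,\varphi(x))$, with the leafwise complex foliation induced by $\{x=\mathrm{const}\}$. Its boundary leaf is $H=\mathbb C^*/\lambda^{\mathbb Z}$, the image of $\{x=0\}$, and $\mathrm{Aut}(R_{\varphi,\lambda},H)$ is the group of the automorphisms of $R_{\varphi,\lambda}$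 that restrict to the identity on $H$. *Turbulization.* Let $(M_0,\mathcal F_0,J_0)$ be a Hausdorff 3-manifold with a leafwise complex foliation, and let $U\cong\{|w|<1\}\times\mathbb R/\mathbb Z\ni(w,t)$ be an open tubular neighbourhood of a closed transversal $K=\{0\}\times\mathbb R/\mathbb Z$, isomorphic to this product with leaves $\{t=\mathrm{const}\}$ and the standard complex structure. Let $\lambda',\varphi'$ be as above, and choose a smooth curve $G_t\in\mathbb C^*$ $(t\in\mathbb R)$ with $G_0=1$, $G_{t+1}=\lambda' G_t$, a smooth curve $\psi_t\in\mathrm{Diff}^\infty((-\infty,0])$ with $\psi_0=\mathrm{id}$, $\psi_{t+1}=\psi_1\circ\psi_t$, $\partial\psi_t(x)/\partial t>0$ for $x<0$, a point $x_0<0$, and a sign $\varepsilon\in\{1,-1\}$. A Hausdorff 3-manifold with a leafwise complex foliation $(M_1,\mathcal F_1,J_1)$ is *obtained by turbulization along $K$, with new Reeb component $R_{\varphi',\lambda'}$*, if $M_1$ is, as a set, the disjoint union of $M_0\setminus K$ and $R_{\varphi',\lambda'}$, the given structures on $M_0\setminus K$ and on the interior of $R_{\varphi',\lambda'}$ are the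 restrictions of that of $M_1$, and the following map $q$ is a local isomorphism into $M_1$. It is defined on the open set of all $(z,x)\in\mathbb C^*\times\mathbb R$ such that $x\ge0$ or $(z,x)=(G_tw,\psi_t(x_0))$ with $0<|w|<1$, by $q(G_tw,\psi_t(x_0))=(w,t)\in U\setminus K$ and $q(z,x)=[z^{\varepsilon},x]\in R_{\varphi',\lambda'}$ for $x\ge0$. ($\varepsilon=1$ is the standard turbulization, $\varepsilon=-1$ the one with the Reeb component upside down.) **Theorem 4.2.** Let $(M_1,\mathcal F_1,J_1)$ be obtained from $(M_0,\mathcal F_0,J_0)$ by turbulization along a closed transversal, with new Reeb component $R'=R_{\varphi',\lambda'}\subset M_1$, and let $\varphi'$ be infinitely tangent to the identity at $0$. Let $h:R_{\varphi,\lambda}\to R'$ be an isomorphism, for some $\varphi$ and $\lambda$ as above. Then $\mathrm{Aut}(M_1,\mathcal F_1,J_1)$ contains a subgroup isomorphic to $\mathrm{Aut}(R_{\varphi,\lambda},H)$. Naturally so: the isomorphism can be chosen to send $f\in\mathrm{Aut}(R_{\varphi,\lambda},H)$ to an automorphism of $M_1$ that equals $h\circ f\circ h^{-1}$ on $R'$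 and the identity on $M_1\setminus R'$. -/

import Mathlib

open Set Filter Topology
open scoped NNReal Manifold ContDiff

noncomputable section

namespace LeafwiseComplex

/-! ### The pseudogroup of leafwise holomorphic foliated coordinate changes

The models are `ℂ × ℝ` (manifolds without boundary) and `ℂ × [0, ∞)` (manifolds whose boundary
is a union of leaves).  Coordinates are `(z, x)`; the leaves of the model are `{x = const}`. -/

/-- A self-map `f` of the model `ℂ × X` (`X = ℝ` or `X = [0, ∞)`) respects the leafwise complex
product structure on `s`: the transverse coordinate of `f (z, x)` is locally independent of `z`,
and the leaf coordinate of `f (z, x)` is holomorphic in `z` for fixed `x`. -/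
def IsLeafwiseHolomorphicOn {X : Type*} (f : ℂ × X → ℂ × X) (s : Set (ℂ × X)) : Prop :=
  ∀ p ∈ s, (∀ᶠ z in 𝓝 p.1, (f (z, p.2)).2 = (f p).2) ∧
    DifferentiableAt ℂ (fun z : ℂ => (f (z, p.2)).1) p.1

/-- Smooth (for the model with corners `I`) and leafwise holomorphic maps of the model. -/
def leafwisePregroupoid {X : Type*} [TopologicalSpace X]
    (I : ModelWithCorners ℝ (ℂ × ℝ) (ℂ × X)) : Pregroupoid (ℂ × X) where
  property f s := (contDiffPregroupoid ∞ I).property f s ∧ IsLeafwiseHolomorphicOn f s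
  comp := by
    intro f g u v hf hg hu hv huv
    refine ⟨(contDiffPregroupoid ∞ I).comp hf.1 hg.1 hu hv huv, ?_⟩
    rintro ⟨z, x⟩ ⟨hpu, hpv⟩
    obtain ⟨hf1, hf2⟩ := hf.2 _ hpu
    obtain ⟨hg1, hg2⟩ := hg.2 _ hpv
    have heq : ∀ᶠ z' in 𝓝 z, f (z', x) = ((f (z', x)).1, (f (z, x)).2) := by
      filter_upwards [hf1] with z' hz'
      exact Prod.ext rfl hz'
    refine ⟨?_, ?_⟩
    · have h1 := hf2.continuousAt.eventually hg1
      filter_upwards [heq, h1] with z' h2 h3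
      simp only [Function.comp_apply]
      rw [h2]
      exact h3
    · have h1 : DifferentiableAt ℂ (fun z' => (g ((f (z', x)).1, (f (z, x)).2)).1) z :=
        DifferentiableAt.comp z (f := fun z' => (f (z', x)).1)
          (g := fun y => (g (y, (f (z, x)).2)).1) hg2 hf2
      refine h1.congr_of_eventuallyEq ?_
      filter_upwards [heq] with z' h2
      simp only [Function.comp_apply]
      rw [h2]
  id_mem := ⟨(contDiffPregroupoid ∞ I).id_mem, fun p _ =>
    ⟨Eventually.of_forall fun _ => rfl, differentiableAt_id⟩⟩
  locality := by
    intro f u hu H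
    refine ⟨(contDiffPregroupoid ∞ I).locality hu fun x hx => ?_, fun p hp => ?_⟩
    · obtain ⟨v, hv, hxv, h⟩ := H x hx
      exact ⟨v, hv, hxv, h.1⟩
    · obtain ⟨v, _, hxv, h⟩ := H p hp
      exact h.2 p ⟨hp, hxv⟩
  congr := by
    intro f g u hu hfg hf
    refine ⟨(contDiffPregroupoid ∞ I).congr hu hfg hf.1, ?_⟩
    rintro ⟨z, x⟩ hp
    obtain ⟨h1, h2⟩ := hf.2 _ hp
    have hev : ∀ᶠ z' in 𝓝 z, g (z', x) = f (z', x) := by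
      have hc : ContinuousAt (fun z' : ℂ => (z', x)) z := by fun_prop
      filter_upwards [hc.eventually (hu.mem_nhds hp)] with z' hz'
      exact hfg _ hz'
    refine ⟨?_, h2.congr_of_eventuallyEq ?_⟩
    · filter_upwards [h1, hev] with z' h3 h4
      rw [h4, hfg _ hp]
      exact h3
    · filter_upwards [hev] with z' h4
      rw [h4]

/-- The pseudogroup of local diffeomorphisms of the model that are, together with their inverses,
leafwise holomorphic. -/
def leafwiseGroupoid {X : Type*} [TopologicalSpace X]
    (I : ModelWithCorners ℝ (ℂ × ℝ) (ℂ × X)) : StructureGroupoid (ℂ × X) :=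
  (leafwisePregroupoid I).groupoid

/-- The inclusion `ℂ × [0, ∞) → ℂ × ℝ` as a model with corners. -/
def halfModel : ModelWithCorners ℝ (ℂ × ℝ) (ℂ × ℝ≥0) :=
  ModelWithCorners.ofConvexRange
    { toFun := fun p => (p.1, (p.2 : ℝ))
      invFun := fun p => (p.1, p.2.toNNReal)
      source := univ
      target := {p | 0 ≤ p.2}
      map_source' := fun p _ => p.2.2
      map_target' := fun _ _ => mem_univ _
      left_inv' := fun p _ => by simp
      right_inv' := fun p hp => by
        have hp' : (0 : ℝ) ≤ p.2 := hp
        simp [hp'] }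
    rfl
    (by
      have h : {p : ℂ × ℝ | 0 ≤ p.2} = univ ×ˢ Ici (0 : ℝ) := by ext; simp
      change Convex ℝ {p : ℂ × ℝ | 0 ≤ p.2}
      rw [h]
      exact convex_univ.prod (convex_Ici 0))
    (continuous_fst.prodMk (NNReal.continuous_coe.comp continuous_snd))
    (continuous_fst.prodMk (continuous_real_toNNReal.comp continuous_snd))
    (by
      refine ⟨((0 : ℂ), (1 : ℝ)), ?_⟩
      have ho : IsOpen {p : ℂ × ℝ | 0 < p.2} := isOpen_lt continuous_const continuous_snd
      refine interior_maximal (fun p hp => ?_) ho (show (0 : ℝ) < 1 from one_pos)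
      exact le_of_lt (show (0 : ℝ) < p.2 from hp))

/-- The pseudogroup defining leafwise complex foliations of 3-manifolds without boundary: a
leafwise complex foliation on `M` is an atlas of charts in `ℂ × ℝ` whose coordinate changes lie in
it, i.e. `[ChartedSpace (ℂ × ℝ) M] [HasGroupoid M fol]`. -/
def fol : StructureGroupoid (ℂ × ℝ) := leafwiseGroupoid 𝓘(ℝ, ℂ × ℝ)

/-- The analogous pseudogroup for 3-manifolds with boundary, tangent to the boundary. -/
def folBdry : StructureGroupoid (ℂ × ℝ≥0) := leafwiseGroupoid halfModel

/-- The automorphism group of a manifold `M` modelled on a pseudogroup `G`.  For `G = fol` or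
`folBdry` this is the group of the diffeomorphisms of `M` that preserve the foliation and are
biholomorphic on leaves. -/
def aut {H : Type*} [TopologicalSpace H] (G : StructureGroupoid H) (M : Type*)
    [TopologicalSpace M] [ChartedSpace H M] [HasGroupoid M G] : Subgroup (M ≃ₜ M) where
  carrier := {f | ∀ c c' : OpenPartialHomeomorph M H, c ∈ atlas H M → c' ∈ atlas H M →
    c.symm ≫ₕ f.toOpenPartialHomeomorph ≫ₕ c' ∈ G}
  mul_mem' {f g} hf hg :=
    ((⟨g, hg⟩ : Structomorph G M M).trans (⟨f, hf⟩ : Structomorph G M M)).mem_groupoid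
  one_mem' := (Structomorph.refl (G := G) M).mem_groupoid
  inv_mem' {f} hf := (Structomorph.symm (⟨f, hf⟩ : Structomorph G M M)).mem_groupoid

/-- On `s`, the map `f` is a local isomorphism of leafwise complex foliations: in charts, near
every point of `s`, it agrees on `s` with an element of the pseudogroup. -/
def IsLocalIsoOn {M N : Type*} [TopologicalSpace M] [TopologicalSpace N] [ChartedSpace (ℂ × ℝ) M]
    [ChartedSpace (ℂ × ℝ) N] (f : M → N) (s : Set M) : Prop :=
  ChartedSpace.LiftPropOn fol.IsLocalStructomorphWithinAt f s

/-! ### Reeb components by the Hopf construction -/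

/-- A complex number `lam` with `|lam| > 1` and an expanding diffeomorphism `phi` of the half line
`[0, ∞)`.  (A homeomorphism of `[0, ∞)` is the same as an order isomorphism.) -/
structure HopfData where
  lam : ℂ
  one_lt_norm_lam : 1 < ‖lam‖
  phi : ℝ≥0 ≃o ℝ≥0
  contDiffOn_phi : ContDiffOn ℝ ∞ (fun x : ℝ => (phi x.toNNReal : ℝ)) (Ici 0)
  contDiffOn_phi_symm : ContDiffOn ℝ ∞ (fun x : ℝ => (phi.symm x.toNNReal : ℝ)) (Ici 0)
  expanding : ∀ x : ℝ≥0, 0 < x → x < phi x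

namespace HopfData

variable (D : HopfData)

/-- `phi` is infinitely tangent to the identity at `0`. -/
def IsFlat : Prop :=
  ∀ n : ℕ, iteratedDerivWithin n (fun x : ℝ => (D.phi x.toNNReal : ℝ) - x) (Ici 0) 0 = 0

theorem lam_ne_zero : D.lam ≠ 0 := by
  intro h
  have := D.one_lt_norm_lam
  rw [h, norm_zero] at this
  linarith

/-- The map `T (z, x) = (lam * z, phi x)`. -/
def deck : (ℂ × ℝ≥0) ≃ₜ (ℂ × ℝ≥0) :=
  (Homeomorph.mulLeft₀ D.lam D.lam_ne_zero).prodCongr D.phi.toHomeomorph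

/-- `ℂ × [0, ∞)` without the point `(0, 0)`. -/
abbrev Cover : Type := {p : ℂ × ℝ≥0 // p ≠ (0, 0)}

/-- Two points are equivalent when they are in the same orbit of `T`. -/
def orbitSetoid : Setoid Cover where
  r p q := ∃ k : ℤ, (D.deck ^ k) p.1 = q.1
  iseqv :=
    { refl := fun _ => ⟨0, rfl⟩
      symm := by
        rintro p q ⟨k, hk⟩
        refine ⟨-k, ?_⟩
        rw [← hk, ← Homeomorph.mul_apply, ← zpow_add]
        simp
      trans := by
        rintro p q s ⟨k, hk⟩ ⟨l, hl⟩
        refine ⟨l + k, ?_⟩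
        rw [zpow_add, Homeomorph.mul_apply, hk, hl] }

/-- The Reeb component `R = (ℂ × [0, ∞) ∖ {(0, 0)}) / T^ℤ`. -/
def Reeb : Type := Quotient D.orbitSetoid

instance : TopologicalSpace D.Reeb := inferInstanceAs (TopologicalSpace (Quotient D.orbitSetoid))

/-- The projection to the quotient. -/
def proj (p : Cover) : D.Reeb := Quotient.mk D.orbitSetoid p

theorem proj_eq_iff {p q : Cover} : D.proj p = D.proj q ↔ ∃ k : ℤ, (D.deck ^ k) p.1 = q.1 :=
  Quotient.eq (r := D.orbitSetoid)

theorem continuous_proj : Continuous D.proj := continuous_quot_mk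

theorem deck_ne_zero {p : ℂ × ℝ≥0} (hp : p ≠ (0, 0)) (k : ℤ) : (D.deck ^ k) p ≠ (0, 0) := by
  have h0 : D.deck (0, 0) = (0, 0) := by
    have : D.phi 0 = 0 := D.phi.map_bot
    simp [deck, this]
  have hk : (D.deck ^ k) (0, 0) = (0, 0) := by
    have hs : D.deck ∈ {f : (ℂ × ℝ≥0) ≃ₜ (ℂ × ℝ≥0) | f (0, 0) = (0, 0)} := h0
    let S : Subgroup ((ℂ × ℝ≥0) ≃ₜ (ℂ × ℝ≥0)) :=
      { carrier := {f | f (0, 0) = (0, 0)}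
        mul_mem' := by
          intro f g hf hg
          have hf' : f (0, 0) = (0, 0) := hf
          have hg' : g (0, 0) = (0, 0) := hg
          simp [hf', hg']
        one_mem' := rfl
        inv_mem' := by
          intro f hf
          have hf' : f (0, 0) = (0, 0) := hf
          change f.symm (0, 0) = (0, 0)
          rw [Homeomorph.symm_apply_eq, hf'] }
    exact S.zpow_mem (x := D.deck) h0 k
  intro h
  exact hp ((D.deck ^ k).injective (h.trans hk.symm))

theorem isOpenMap_proj : IsOpenMap D.proj := by
  intro V hV
  have hq : IsQuotientMap D.proj := isQuotientMap_quot_mk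
  rw [← hq.isOpen_preimage]
  have h : D.proj ⁻¹' (D.proj '' V) =
      ⋃ k : ℤ, (fun p : Cover => (⟨(D.deck ^ k) p.1, D.deck_ne_zero p.2 k⟩ : Cover)) ⁻¹' V := by
    ext p
    simp only [mem_preimage, mem_image, mem_iUnion]
    constructor
    · rintro ⟨q, hq, h⟩
      obtain ⟨k, hk⟩ := D.proj_eq_iff.1 h.symm
      refine ⟨k, ?_⟩
      convert hq
    · rintro ⟨k, hk⟩
      exact ⟨_, hk, (D.proj_eq_iff.2 ⟨k, rfl⟩).symm⟩
  rw [h]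
  refine isOpen_iUnion fun k => hV.preimage ?_
  exact Continuous.subtype_mk ((D.deck ^ k).continuous.comp continuous_subtype_val) _

theorem le_deck_pow (n : ℕ) (p : ℂ × ℝ≥0) :
    ‖p.1‖ ≤ ‖((D.deck ^ n) p).1‖ ∧ p.2 ≤ ((D.deck ^ n) p).2 := by
  induction n generalizing p with
  | zero => simp
  | succ n ih =>
    have h := ih (D.deck p)
    rw [pow_succ, Homeomorph.mul_apply]
    refine ⟨le_trans ?_ h.1, le_trans ?_ h.2⟩
    · change ‖p.1‖ ≤ ‖D.lam * p.1‖
      rw [norm_mul]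
      exact le_mul_of_one_le_left (norm_nonneg _) D.one_lt_norm_lam.le
    · change p.2 ≤ D.phi p.2
      rcases eq_or_lt_of_le (zero_le : 0 ≤ p.2) with h0 | h0
      · rw [← h0]; exact zero_le
      · exact (D.expanding _ h0).le

theorem exists_injOn_proj (p : Cover) : ∃ V : Set Cover, IsOpen V ∧ p ∈ V ∧ InjOn D.proj V := by
  have key : ∀ V : Set Cover,
      (∀ a ∈ V, ∀ b ∈ V, ∀ n : ℕ, (D.deck ^ n) (D.deck a.1) ≠ b.1) → InjOn D.proj V := by
    intro V hV a ha b hb hab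
    obtain ⟨k, hk⟩ := D.proj_eq_iff.1 hab
    rcases lt_trichotomy k 0 with h | h | h
    · obtain ⟨n, hn⟩ := Int.eq_ofNat_of_zero_le (show 0 ≤ -k - 1 by omega)
      exfalso
      refine hV b hb a ha n ?_
      rw [← Homeomorph.mul_apply, ← pow_succ, ← hk, ← zpow_natCast, ← Homeomorph.mul_apply,
        ← zpow_add]
      have : ((n + 1 : ℕ) : ℤ) + k = 0 := by push_cast; omega
      rw [this]
      simp
    · subst h
      exact Subtype.ext (by simpa using hk)
    · obtain ⟨n, hn⟩ := Int.eq_ofNat_of_zero_le (show 0 ≤ k - 1 by omega)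
      exfalso
      refine hV a ha b hb n ?_
      rw [← Homeomorph.mul_apply, ← pow_succ, ← hk, ← zpow_natCast]
      have : ((n + 1 : ℕ) : ℤ) = k := by push_cast; omega
      rw [this]
  obtain ⟨⟨z, x⟩, hp⟩ := p
  by_cases hz : z = 0
  · have hx : 0 < x := by
      rw [pos_iff_ne_zero]
      rintro rfl
      exact hp (by rw [hz])
    have hx' : D.phi.symm x < x := by
      rw [D.phi.symm_apply_lt]
      exact D.expanding x hx
    obtain ⟨a, ha1, ha2⟩ := exists_between hx'
    rw [D.phi.symm_apply_lt] at ha1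
    refine ⟨{p | a < p.1.2 ∧ p.1.2 < D.phi a}, ?_, ⟨ha2, ha1⟩, key _ ?_⟩
    · have hc : Continuous fun p : Cover => p.1.2 := continuous_snd.comp continuous_subtype_val
      exact (isOpen_Ioi.preimage hc).inter (isOpen_Iio.preimage hc)
    · intro p hp q hq n h
      have h1 := (D.le_deck_pow n (D.deck p.1)).2
      rw [h] at h1
      have h2 : D.phi a < D.phi p.1.2 := D.phi.lt_iff_lt.2 hp.1
      exact absurd (lt_of_lt_of_le h2 h1) (not_lt.2 hq.2.le)
  · have hz' : 0 < ‖z‖ := norm_pos_iff.2 hz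
    obtain ⟨r, hr1, hr2⟩ := exists_between
      (show ‖z‖ / ‖D.lam‖ < ‖z‖ from div_lt_self hz' D.one_lt_norm_lam)
    have hl : 0 < ‖D.lam‖ := lt_trans one_pos D.one_lt_norm_lam
    rw [div_lt_iff₀ hl] at hr1
    refine ⟨{p | r < ‖p.1.1‖ ∧ ‖p.1.1‖ < r * ‖D.lam‖}, ?_, ⟨hr2, hr1⟩, key _ ?_⟩
    · have hc : Continuous fun p : Cover => ‖p.1.1‖ :=
        (continuous_fst.comp continuous_subtype_val).norm
      exact (isOpen_Ioi.preimage hc).inter (isOpen_Iio.preimage hc)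
    · intro p hp q hq n h
      have h1 := (D.le_deck_pow n (D.deck p.1)).1
      rw [h] at h1
      have h2 : ‖(D.deck p.1).1‖ = ‖D.lam‖ * ‖p.1.1‖ := norm_mul _ _
      rw [h2] at h1
      have h3 := hp.1
      have h4 := hq.2
      nlinarith

/-- The atlas of `R`: all the local inverses of the projection. -/
def reebAtlas : Set (OpenPartialHomeomorph D.Reeb (ℂ × ℝ≥0)) :=
  {e | ∀ p ∈ e.target, ∃ hp : p ≠ (0, 0), e.symm p = D.proj ⟨p, hp⟩}

theorem exists_chart (y : D.Reeb) : ∃ e ∈ D.reebAtlas, y ∈ e.source := by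
  obtain ⟨p, rfl⟩ : ∃ p, D.proj p = y := Quotient.exists_rep y
  obtain ⟨V, hV, hpV, hinj⟩ := D.exists_injOn_proj p
  have hne : Nonempty Cover := ⟨p⟩
  let e₀ : OpenPartialHomeomorph Cover D.Reeb :=
    OpenPartialHomeomorph.ofContinuousOpen (hinj.toPartialEquiv D.proj V)
      D.continuous_proj.continuousOn D.isOpenMap_proj hV
  have hemb : IsOpenEmbedding (Subtype.val : Cover → ℂ × ℝ≥0) :=
    (isOpen_ne (x := ((0 : ℂ), (0 : ℝ≥0)))).isOpenEmbedding_subtypeVal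
  let i := hemb.toOpenPartialHomeomorph
  refine ⟨e₀.symm ≫ₕ i, ?_, ?_⟩
  · intro q hq
    obtain ⟨q', rfl⟩ : q ∈ range (Subtype.val : Cover → ℂ × ℝ≥0) := by
      have := hq.1
      simpa [i] using this
    refine ⟨q'.2, ?_⟩
    change e₀ (i.symm q'.1) = _
    have : i.symm q'.1 = q' := i.left_inv (x := q') (by simp [i])
    rw [this]
    rfl
  · refine ⟨⟨p, hpV, rfl⟩, ?_⟩
    simp [i]

instance : ChartedSpace (ℂ × ℝ≥0) D.Reeb where
  atlas := D.reebAtlas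
  chartAt y := (D.exists_chart y).choose
  mem_chart_source y := (D.exists_chart y).choose_spec.2
  chart_mem_atlas y := (D.exists_chart y).choose_spec.1

theorem deck_mem : D.deck ∈ aut folBdry (ℂ × ℝ≥0) := by
  have hrange : ∀ s, halfModel.symm ⁻¹' s ∩ range halfModel ⊆ univ ×ˢ Ici (0 : ℝ) := by
    rintro s _ ⟨_, p, rfl⟩
    exact ⟨mem_univ _, p.2.2⟩
  have h1 : (leafwisePregroupoid halfModel).property D.deck univ := by
    refine ⟨?_, fun p _ => ⟨Eventually.of_forall fun _ => rfl, ?_⟩⟩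
    · refine ContDiffOn.mono ?_ (hrange _)
      exact (contDiff_const.mul contDiff_fst).contDiffOn.prodMk
        (D.contDiffOn_phi.comp contDiff_snd.contDiffOn fun p hp => hp.2)
    · exact differentiableAt_id.const_mul D.lam
  have h2 : (leafwisePregroupoid halfModel).property D.deck.symm univ := by
    refine ⟨?_, fun p _ => ⟨Eventually.of_forall fun _ => rfl, ?_⟩⟩
    · refine ContDiffOn.mono ?_ (hrange _)
      exact (contDiff_const.mul contDiff_fst).contDiffOn.prodMk
        (D.contDiffOn_phi_symm.comp contDiff_snd.contDiffOn fun p hp => hp.2)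
    · exact differentiableAt_id.const_mul D.lam⁻¹
  have h3 : D.deck.toOpenPartialHomeomorph ∈ folBdry := ⟨h1, h2⟩
  rintro c c' hc hc'
  rw [chartedSpaceSelf_atlas] at hc hc'
  subst hc hc'
  rw [OpenPartialHomeomorph.trans_refl, OpenPartialHomeomorph.refl_symm,
    OpenPartialHomeomorph.refl_trans]
  exact h3

instance : HasGroupoid D.Reeb folBdry where
  compatible := by
    have key : ∀ e ∈ D.reebAtlas, ∀ e' ∈ D.reebAtlas,
        (leafwisePregroupoid halfModel).property (e.symm ≫ₕ e') (e.symm ≫ₕ e').source := by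
      intro e he e' he'
      refine (leafwisePregroupoid halfModel).locality (e.symm ≫ₕ e').open_source fun p hp => ?_
      have hp1 : p ∈ e.target := hp.1
      have hp2 : e.symm p ∈ e'.source := hp.2
      obtain ⟨hp0, hpe⟩ := he p hp1
      obtain ⟨hq0, hqe⟩ := he' (e' (e.symm p)) (e'.map_source hp2)
      replace hqe := (hpe.symm.trans (e'.left_inv hp2).symm).trans hqe
      obtain ⟨k, hk⟩ := D.proj_eq_iff.1 hqe
      simp only at hk
      have hmem := (aut folBdry (ℂ × ℝ≥0)).zpow_mem D.deck_mem k
      have hprop : (leafwisePregroupoid halfModel).property ⇑(D.deck ^ k) univ := by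
        have h := hmem (OpenPartialHomeomorph.refl _) (OpenPartialHomeomorph.refl _) rfl rfl
        rw [OpenPartialHomeomorph.trans_refl, OpenPartialHomeomorph.refl_symm,
          OpenPartialHomeomorph.refl_trans] at h
        exact h.1
      have hV : IsOpen ((D.deck ^ k) ⁻¹' e'.target) :=
        e'.open_target.preimage (D.deck ^ k).continuous
      refine ⟨_, hV, ?_, ?_⟩
      · rw [mem_preimage, hk]
        exact e'.map_source hp2
      · refine (leafwisePregroupoid halfModel).congr ((e.symm ≫ₕ e').open_source.inter hV)
          (f := ⇑(D.deck ^ k)) ?_ ⟨hprop.1.mono ?_, fun x _ => hprop.2 x (mem_univ _)⟩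
        · rintro x ⟨hx1, hx2⟩
          obtain ⟨hx0, hxe⟩ := he x hx1.1
          obtain ⟨hy0, hye⟩ := he' _ hx2
          have : e.symm x = e'.symm ((D.deck ^ k) x) := by
            rw [hxe, hye]
            exact D.proj_eq_iff.2 ⟨k, rfl⟩
          change e' (e.symm x) = _
          rw [this]
          exact e'.right_inv hx2
        · exact inter_subset_inter_left _ (preimage_mono (subset_univ _))
    intro e e' he he'
    refine ⟨key e he e' he', ?_⟩
    exact key e' he' e he

/-- The boundary leaf `H` of the Reeb component: the image of `{x = 0}`. -/
def boundaryLeaf : Set D.Reeb := D.proj '' {p | p.1.2 = 0}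

/-- `Aut (R, H)`: the automorphisms of `R` whose restriction to the boundary leaf `H` is the
identity. -/
def autRel : Subgroup (D.Reeb ≃ₜ D.Reeb) :=
  aut folBdry D.Reeb ⊓
    { carrier := {f | ∀ y ∈ D.boundaryLeaf, f y = y}
      mul_mem' := fun {f g} hf hg y hy => by
        rw [Homeomorph.mul_apply, hg y hy, hf y hy]
      one_mem' := fun _ _ => rfl
      inv_mem' := fun {f} hf y hy => by
        rw [Homeomorph.inv_apply, Homeomorph.symm_apply_eq, hf y hy] }

/-- The class in `R` of `(z, x)`, for `x ≥ 0` and `(z, x) ≠ (0, 0)`; meaningless otherwise. -/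
def point (z : ℂ) (x : ℝ) : D.Reeb :=
  if h : (z, x.toNNReal) ≠ ((0 : ℂ), (0 : ℝ≥0)) then D.proj ⟨(z, x.toNNReal), h⟩
  else D.proj ⟨(1, 0), by simp⟩

end HopfData

/-! ### Turbulization -/

/-- A tubular neighbourhood of a closed transversal in a leafwise complex foliation, isomorphic to
`int D × S¹` with the leaves `int D × {t}`.  Here `D` is the unit disc of `ℂ` and `S¹ = ℝ / ℤ`, and
the isomorphism is given by the map `toFun`, `1`-periodic in `t`. -/
structure TransversalTube (M : Type*) [TopologicalSpace M] [ChartedSpace (ℂ × ℝ) M] where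
  toFun : ℂ × ℝ → M
  isLocalIsoOn : IsLocalIsoOn toFun {p | ‖p.1‖ < 1}
  eq_iff : ∀ w w' : ℂ, ∀ t t' : ℝ, ‖w‖ < 1 → ‖w'‖ < 1 →
    (toFun (w, t) = toFun (w', t') ↔ w = w' ∧ ∃ k : ℤ, t' = t + k)

/-- The closed transversal `{0} × S¹`. -/
def TransversalTube.core {M : Type*} [TopologicalSpace M] [ChartedSpace (ℂ × ℝ) M]
    (U : TransversalTube M) : Set M :=
  {m | ∃ t : ℝ, m = U.toFun (0, t)}

/-- Smooth curves `G_t` in `GL(1, ℂ)` and `psi_t` in `Diff^∞((-∞, 0])` with `G_k = lam ^ k` and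
`psi_k = psi_1 ^ k` for integers `k`, with `G_{t+1} = lam * G_t`, `psi_{t+1} = psi_1 ∘ psi_t` and
`∂ psi_t (x) / ∂ t > 0` for `x < 0`, and a base point `x₀ < 0`. -/
structure SpiralData (lam : ℂ) where
  G : ℝ → ℂ
  contDiff_G : ContDiff ℝ ∞ G
  G_ne_zero : ∀ t, G t ≠ 0
  G_zero : G 0 = 1
  G_add_one : ∀ t, G (t + 1) = lam * G t
  psi : ℝ → ℝ → ℝ
  contDiffOn_psi : ContDiffOn ℝ ∞ (fun p : ℝ × ℝ => psi p.1 p.2) (univ ×ˢ Iic 0)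
  bijOn_psi : ∀ t, BijOn (psi t) (Iic 0) (Iic 0)
  derivWithin_psi_pos : ∀ t, ∀ x ≤ 0, 0 < derivWithin (psi t) (Iic 0) x
  psi_zero : ∀ x ≤ 0, psi 0 x = x
  psi_add_one : ∀ t, ∀ x ≤ 0, psi (t + 1) x = psi 1 (psi t x)
  deriv_psi_pos : ∀ t, ∀ x < 0, 0 < deriv (fun s => psi s x) t
  x₀ : ℝ
  x₀_neg : x₀ < 0

/-- The set of the `(z, x)` with `z ≠ 0` such that, if `x < 0`, then `(z, x) = (G_t w, psi_t x₀)`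
for some `(w, t)` with `|w| < 1`.  It is an open neighbourhood of `{z ≠ 0, x = 0}`. -/
def SpiralData.collar {lam : ℂ} (S : SpiralData lam) : Set (ℂ × ℝ) :=
  {p | p.1 ≠ 0 ∧ (p.2 < 0 → ∃ w : ℂ, ∃ t : ℝ, ‖w‖ < 1 ∧ p = (S.G t * w, S.psi t S.x₀))}

/-- `M₁` is obtained from `M₀` by turbulization along a closed transversal `K`, with the new Reeb
component `R = R_{phi, lam}`.

As a set `M₁` is the disjoint union of `M₀ ∖ K` (embedded by `outer`) and of `R` (embedded by
`reeb`).  The structure of `M₁` is the given one on `M₀ ∖ K` and on the interior of `R`.  Across the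
boundary leaf `H` of `R` it is given by the coordinates `(z, x)` in which `x < 0` is the punctured
tube, through the substitution `z = G_t w`, `x = psi_t x₀`, and `x ≥ 0` is a neighbourhood of `H` in
`R`, through `(z, x) ↦ [z, x]` (`sign = 1`) or, for the upside-down Reeb component, through
`(z, x) ↦ [1 / z, x]` (`sign = -1`).

So the three maps `outer`, `reeb` and `collarMap` exhibit `M₁` as the result of gluing. -/
structure Turbulization (M₀ M₁ : Type*) [TopologicalSpace M₀] [ChartedSpace (ℂ × ℝ) M₀]
    [TopologicalSpace M₁] [ChartedSpace (ℂ × ℝ) M₁] (D : HopfData) where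
  tube : TransversalTube M₀
  spiral : SpiralData D.lam
  sign : ℤ
  sign_eq : sign = 1 ∨ sign = -1
  outer : M₀ → M₁
  reeb : D.Reeb → M₁
  collarMap : ℂ × ℝ → M₁
  injOn_outer : InjOn outer tube.coreᶜ
  injective_reeb : Function.Injective reeb
  range_reeb : range reeb = (outer '' tube.coreᶜ)ᶜ
  isLocalIsoOn_outer : IsLocalIsoOn outer tube.coreᶜ
  isLocalIsoOn_reeb : IsLocalIsoOn (fun p : ℂ × ℝ => reeb (D.point p.1 p.2)) {p | 0 < p.2}
  isLocalIsoOn_collarMap : IsLocalIsoOn collarMap spiral.collar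
  collarMap_neg : ∀ w : ℂ, ∀ t : ℝ, w ≠ 0 → ‖w‖ < 1 →
    collarMap (spiral.G t * w, spiral.psi t spiral.x₀) = outer (tube.toFun (w, t))
  collarMap_nonneg : ∀ z : ℂ, ∀ x : ℝ, z ≠ 0 → 0 ≤ x →
    collarMap (z, x) = reeb (D.point (z ^ sign) x)

end LeafwiseComplex
end

noncomputable section

namespace LeafwiseComplex

/-! ### One-sided flatness -/

section Flat

open Asymptotics

variable {E : Type*} [NormedAddCommGroup E] [NormedSpace ℝ E]

/-! The natural candidate works: conjugate `f` by `h` and extend by the identity outside the new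
Reeb component. Multiplicativity and injectivity are then immediate; the content is that the
extension is smooth and leafwise holomorphic across the boundary leaf, and this is where flatness of
the holonomy enters.

An automorphism fixing the boundary leaf pointwise lifts to the simply connected cover as a map `F`
that commutes with `T` and is the identity on `{x = 0}` (`exists_lift`). For `x > 0` the leaf
upstairs is all of `ℂ`, and equivariance under `T` gives `F` linear growth in `z`, so by Liouville
`F (z, x) = (α x * z + β x, b x)`. Moreover `α` is invariant under `phi`, continuous, and equal to
`1` at `0`, hence identically `1` (`exists_affine_form`). There remain `β (phi x) = lam * β x` and
`b` commuting with `phi`.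

If `phi` is flat, both are flat. A leading Taylor coefficient `c` of `β` would satisfy `c = lam *
c`, with `lam ≠ 1`; and `b`, `b⁻¹` are dominated near `0` by iterates of `phi`, which are flat. So
`β` and `b` extend smoothly to `x < 0` by `0` and the identity (`exists_normal_form`). In collar
coordinates the extended automorphism is therefore the shear `(z, x) ↦ (z + β x, b x)`, conjugated
by `z ↦ 1 / z` when the component is upside down, and it is the identity for `x ≤ 0`
(`isLeafwiseAt_extendHom`).

Conjugation by `h` preserves the condition on the boundary leaf because the pseudogroup of the half
model preserves `{x = 0}` (`snd_eq_zero_of_mem_folBdry`). -/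

theorem taylorWithinEval_eq_of_forall_lt {f : ℝ → E} {n : ℕ}
    (h : ∀ k < n, iteratedDerivWithin k f (Ici 0) 0 = 0) (x : ℝ) :
    taylorWithinEval f n (Ici 0) 0 x =
      ((n.factorial : ℝ)⁻¹ * x ^ n) • iteratedDerivWithin n f (Ici 0) 0 := by
  rw [taylor_within_apply, Finset.sum_range_succ, Finset.sum_eq_zero, zero_add, sub_zero]
  intro k hk
  rw [h k (Finset.mem_range.1 hk), smul_zero]

/-- Taylor expansion at `0` of a function on the half line whose first derivatives vanish. -/
theorem isLittleO_sub_leading {f : ℝ → E} (hf : ContDiffOn ℝ ∞ f (Ici 0)) {n : ℕ}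
    (h : ∀ k < n, iteratedDerivWithin k f (Ici 0) 0 = 0) :
    (fun x => f x - ((n.factorial : ℝ)⁻¹ * x ^ n) • iteratedDerivWithin n f (Ici 0) 0)
      =o[𝓝[≥] 0] fun x : ℝ => x ^ n := by
  have := taylor_isLittleO (convex_Ici (0 : ℝ)) self_mem_Ici
    (hf.of_le (by exact_mod_cast le_top) : ContDiffOn ℝ n f (Ici 0))
  simpa only [taylorWithinEval_eq_of_forall_lt h, sub_zero] using this

theorem isLittleO_pow_of_iteratedDerivWithin_eq_zero {f : ℝ → E}
    (hf : ContDiffOn ℝ ∞ f (Ici 0)) (h : ∀ k, iteratedDerivWithin k f (Ici 0) 0 = 0) (n : ℕ) :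
    f =o[𝓝[≥] 0] fun x : ℝ => x ^ n := by
  simpa [h] using isLittleO_sub_leading hf (n := n) fun k _ => h k

theorem eq_zero_of_pow_smul_isLittleO {c : E} {n : ℕ}
    (h : (fun x : ℝ => x ^ n • c) =o[𝓝[≥] 0] fun x : ℝ => x ^ n) : c = 0 := by
  have h1 : (fun x : ℝ => x ^ n • c) =o[𝓝[>] 0] fun x : ℝ => x ^ n :=
    h.mono (nhdsWithin_mono _ Ioi_subset_Ici_self)
  have h2 : (fun _ : ℝ => c) =o[𝓝[>] 0] fun _ : ℝ => (1 : ℝ) := by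
    refine IsLittleO.congr' ((isBigO_refl (fun x : ℝ => (x ^ n)⁻¹) _).smul_isLittleO h1) ?_ ?_
    · filter_upwards [self_mem_nhdsWithin] with x hx
      rw [smul_smul, inv_mul_cancel₀ (pow_ne_zero _ (ne_of_gt hx)), one_smul]
    · filter_upwards [self_mem_nhdsWithin] with x hx
      rw [smul_eq_mul, inv_mul_cancel₀ (pow_ne_zero _ (ne_of_gt hx))]
  simpa using h2

/-- By strong induction: once the lower coefficients vanish, the leading Taylor term is itself `o(x
^ n)`, hence zero. This converts decay estimates into the vanishing of derivatives. -/
theorem iteratedDerivWithin_eq_zero_of_isLittleO {f : ℝ → E} (hf : ContDiffOn ℝ ∞ f (Ici 0))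
    (h : ∀ n : ℕ, f =o[𝓝[≥] 0] fun x : ℝ => x ^ n) (n : ℕ) :
    iteratedDerivWithin n f (Ici 0) 0 = 0 := by
  induction n using Nat.strong_induction_on with
  | _ n ih =>
    have h1 := (h n).sub (isLittleO_sub_leading hf ih)
    have h2 : ((n.factorial : ℝ)⁻¹) • iteratedDerivWithin n f (Ici 0) 0 = 0 := by
      refine eq_zero_of_pow_smul_isLittleO (n := n) (h1.congr_left fun x => ?_)
      rw [smul_smul, sub_sub_cancel, mul_comm]
    exact (smul_eq_zero.1 h2).resolve_left (by positivity)

/-- A smooth function on the half line all of whose derivatives vanish at `0` extends by zero to a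
smooth function on the line. -/
theorem contDiff_indicator_Ici {f : ℝ → E} (hf : ContDiffOn ℝ ∞ f (Ici 0))
    (h : ∀ n, iteratedDerivWithin n f (Ici 0) 0 = 0) : ContDiff ℝ ∞ ((Ici 0).indicator f) := by
  rw [contDiff_infty]
  intro n
  induction n generalizing f with
  | zero =>
    have h0 : f 0 = 0 := by simpa using h 0
    refine contDiff_zero.2 (continuous_indicator (fun a ha => ?_) ?_)
    · rw [frontier_Ici, mem_singleton_iff] at ha
      rw [ha, h0]
    · rw [closure_Ici]
      exact hf.continuousOn
  | succ n ih =>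
    have h0 : f 0 = 0 := by simpa using h 0
    have hd : ContDiffOn ℝ ∞ (derivWithin f (Ici 0)) (Ici 0) :=
      ((contDiffOn_infty_iff_derivWithin (uniqueDiffOn_Ici 0)).1 hf).2
    have hd0 : ∀ n, iteratedDerivWithin n (derivWithin f (Ici 0)) (Ici 0) 0 = 0 := fun n => by
      rw [← iteratedDerivWithin_succ']
      exact h (n + 1)
    -- The derivative of the extension is the extension of the derivative, which is again flat, so
    -- the induction applies to it. At `0` the two one-sided derivatives are both zero.
    have hder : ∀ x, HasDerivAt ((Ici 0).indicator f)
        ((Ici 0).indicator (derivWithin f (Ici 0)) x) x := by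
      intro x
      have hright : ∀ y, 0 ≤ y → HasDerivWithinAt ((Ici 0).indicator f)
          ((Ici 0).indicator (derivWithin f (Ici 0)) y) (Ici 0) y := by
        intro y hy
        rw [indicator_of_mem (show y ∈ Ici (0 : ℝ) from hy)]
        have := ((hf.differentiableOn (by simp)) y hy).hasDerivWithinAt
        exact this.congr (fun z hz => indicator_of_mem hz _) (indicator_of_mem hy _)
      rcases lt_trichotomy x 0 with hx | rfl | hx
      · rw [indicator_of_notMem (by simpa using hx)]
        refine (hasDerivAt_const x (0 : E)).congr_of_eventuallyEq ?_
        filter_upwards [Iio_mem_nhds hx] with y hy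
        exact indicator_of_notMem (by simpa using hy) _
      · have h1 := hright 0 le_rfl
        have h2 : HasDerivWithinAt ((Ici 0).indicator f)
            ((Ici 0).indicator (derivWithin f (Ici 0)) 0) (Iic 0) 0 := by
          have : (Ici (0 : ℝ)).indicator (derivWithin f (Ici 0)) 0 = 0 := by
            rw [indicator_of_mem self_mem_Ici]
            simpa using hd0 0
          rw [this]
          refine (hasDerivWithinAt_const (0 : ℝ) (Iic 0) (0 : E)).congr (fun z hz => ?_) ?_
          · rcases eq_or_lt_of_le (show z ≤ 0 from hz) with rfl | hz
            · rw [indicator_of_mem self_mem_Ici, h0]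
            · exact indicator_of_notMem (by simpa using hz) _
          · rw [indicator_of_mem self_mem_Ici, h0]
        have h3 := h1.union h2
        rwa [Ici_union_Iic, hasDerivWithinAt_univ] at h3
      · exact (hright x hx.le).hasDerivAt (Ici_mem_nhds hx)
    have heq : deriv ((Ici 0).indicator f) = (Ici 0).indicator (derivWithin f (Ici 0)) :=
      funext fun x => (hder x).deriv
    push_cast
    rw [contDiff_succ_iff_deriv]
    refine ⟨fun x => (hder x).differentiableAt, by simp, ?_⟩
    rw [heq]
    exact ih hd hd0

theorem isBigO_pow_comp {F : Type*} [NormedAddCommGroup F] {f : ℝ → F} {g : ℝ → ℝ} {n : ℕ}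
    (hf : f =O[𝓝[≥] 0] fun x : ℝ => x ^ n) (hg : Tendsto g (𝓝[≥] 0) (𝓝[≥] 0))
    (hg' : g =O[𝓝[≥] 0] fun x : ℝ => x) : (f ∘ g) =O[𝓝[≥] 0] fun x : ℝ => x ^ n :=
  (hf.comp_tendsto hg).trans (hg'.pow n)

end Flat

/-! ### Maps commuting with the holonomy of the boundary leaf -/

namespace HopfData

open Asymptotics

variable (D : HopfData)

theorem phi_zero : D.phi 0 = 0 := D.phi.map_bot

theorem le_phi (x : ℝ≥0) : x ≤ D.phi x := by
  rcases eq_or_lt_of_le (zero_le : 0 ≤ x) with h | h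
  · rw [← h]; exact zero_le
  · exact (D.expanding _ h).le

theorem eq_zero_of_phi_eq {x : ℝ≥0} (h : D.phi x = x) : x = 0 := by
  by_contra hx
  exact (D.expanding x (pos_iff_ne_zero.2 hx)).ne' h

/-- A bounded monotone orbit would converge to a positive fixed point of `phi`. -/
theorem exists_le_phi_iterate {x : ℝ≥0} (hx : 0 < x) (B : ℝ≥0) : ∃ N : ℕ, B ≤ D.phi^[N] x := by
  have hmono : Monotone fun n : ℕ => D.phi^[n] x := fun a b hab =>
    Function.monotone_iterate_of_id_le (f := D.phi) D.le_phi hab x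
  rcases tendsto_atTop_of_monotone hmono with h | ⟨l, h⟩
  · exact (h.eventually_ge_atTop B).exists
  · have hfix : D.phi l = l :=
      isFixedPt_of_tendsto_iterate h D.phi.continuous.continuousAt
    have hl : x ≤ l := hmono.ge_of_tendsto h 0
    exact absurd (D.eq_zero_of_phi_eq hfix) (hx.trans_le hl).ne'

theorem tendsto_phi_symm_iterate (x : ℝ≥0) :
    Tendsto (fun n : ℕ => D.phi.symm^[n] x) atTop (𝓝 0) := by
  have hle : ∀ y, D.phi.symm y ≤ y := fun y => by
    rw [D.phi.symm_apply_le]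
    exact D.le_phi y
  have hanti : Antitone fun n : ℕ => D.phi.symm^[n] x := by
    refine antitone_nat_of_succ_le fun n => ?_
    rw [Function.iterate_succ_apply']
    exact hle _
  have h := tendsto_atTop_ciInf hanti (OrderBot.bddBelow _)
  have hfix : D.phi.symm _ = _ :=
    isFixedPt_of_tendsto_iterate h D.phi.symm.continuous.continuousAt
  rw [D.phi.symm_apply_eq] at hfix
  rwa [D.eq_zero_of_phi_eq hfix.symm] at h

theorem iterate_phi_comm {b : ℝ≥0 → ℝ≥0} (hb : ∀ x, b (D.phi x) = D.phi (b x)) (n : ℕ)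
    (x : ℝ≥0) : b (D.phi^[n] x) = D.phi^[n] (b x) :=
  (Function.Semiconj.iterate_right (f := b) (ga := D.phi) (gb := D.phi) hb n) x

/-- A continuous map commuting with `phi` is dominated near `0` by an iterate of `phi`. -/
theorem exists_le_iterate {b : ℝ≥0 → ℝ≥0} (hc : Continuous b)
    (hb : ∀ x, b (D.phi x) = D.phi (b x)) : ∃ N : ℕ, ∀ x ≤ 1, b x ≤ D.phi^[N] x := by
  -- `[1, phi 1]` is a fundamental domain for `phi` on the positive half line, so a bound there
  -- propagates to all of `(0, 1]` by equivariance.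
  obtain ⟨B, hB⟩ := (isCompact_Icc (a := (1 : ℝ≥0)) (b := D.phi 1)).bddAbove_image hc.continuousOn
  obtain ⟨N, hN⟩ := D.exists_le_phi_iterate one_pos B
  refine ⟨N, fun x hx => ?_⟩
  rcases eq_or_lt_of_le (zero_le : 0 ≤ x) with h0 | h0
  · subst h0
    have h1 := hb 0
    rw [D.phi_zero] at h1
    rw [D.eq_zero_of_phi_eq h1.symm]
    exact zero_le
  classical
  have hex := D.exists_le_phi_iterate h0 1
  set n := Nat.find hex with hn
  have h1 : 1 ≤ D.phi^[n] x := Nat.find_spec hex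
  have h2 : D.phi^[n] x ≤ D.phi 1 := by
    rcases hm : n with _ | m
    · exact hx.trans (D.le_phi 1)
    · rw [Function.iterate_succ_apply', D.phi.le_iff_le]
      exact (not_le.1 (Nat.find_min hex (m := m) (by omega))).le
  have hmono : ∀ k, StrictMono D.phi^[k] := fun k => D.phi.strictMono.iterate k
  -- The comparison is made after `n` steps, when the orbit of `x` has entered `[1, phi 1]`; the
  -- increasing map `phi^[n]` is then cancelled.
  have h3 : D.phi^[n] (b x) ≤ D.phi^[n] (D.phi^[N] x) := by
    rw [← D.iterate_phi_comm hb, ← Function.iterate_add_apply, add_comm,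
      Function.iterate_add_apply]
    exact (hB (mem_image_of_mem b ⟨h1, h2⟩)).trans (hN.trans ((hmono N).monotone h1))
  exact (hmono n).le_iff_le.1 h3

variable {D}

theorem isBigO_self_of_flat {f : ℝ → ℝ}
    (h : (fun x => f x - x) =O[𝓝[≥] 0] fun x : ℝ => x ^ 1) : f =O[𝓝[≥] 0] fun x : ℝ => x := by
  simp only [pow_one] at h
  simpa using h.add (isBigO_refl (fun x : ℝ => x) _)

theorem tendsto_of_isBigO_self {f : ℝ → ℝ} (h : f =O[𝓝[≥] 0] fun x : ℝ => x)
    (h0 : ∀ x, 0 ≤ f x) : Tendsto f (𝓝[≥] 0) (𝓝[≥] 0) := by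
  refine tendsto_nhdsWithin_iff.2 ⟨?_, Eventually.of_forall h0⟩
  exact h.trans_tendsto (tendsto_id.mono_left nhdsWithin_le_nhds)

theorem IsFlat.isBigO (hD : D.IsFlat) (n : ℕ) :
    (fun x : ℝ => (D.phi x.toNNReal : ℝ) - x) =O[𝓝[≥] 0] fun x : ℝ => x ^ n :=
  (isLittleO_pow_of_iteratedDerivWithin_eq_zero
    (D.contDiffOn_phi.sub contDiffOn_id) hD n).isBigO

theorem IsFlat.isBigO_iterate (hD : D.IsFlat) (N n : ℕ) :
    (fun x : ℝ => (D.phi^[N] x.toNNReal : ℝ) - x) =O[𝓝[≥] 0] fun x : ℝ => x ^ n := by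
  induction N generalizing n with
  | zero =>
    refine (isBigO_zero (fun x : ℝ => x ^ n) (𝓝[≥] 0)).congr' ?_ EventuallyEq.rfl
    filter_upwards [self_mem_nhdsWithin] with x hx
    simp [Real.coe_toNNReal x hx]
  | succ N ih =>
    have h1 := isBigO_self_of_flat (ih 1)
    have h2 := isBigO_pow_comp (hD.isBigO n) (tendsto_of_isBigO_self h1 fun _ => NNReal.coe_nonneg _)
      h1
    refine (h2.add (ih n)).congr_left fun x => ?_
    simp only [Function.comp_apply, Real.toNNReal_coe, Function.iterate_succ_apply']
    ring

/-- A homeomorphism of the half line commuting with a flat `phi` is itself flat. -/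
theorem IsFlat.isLittleO_of_comm (hD : D.IsFlat) {b c : ℝ≥0 → ℝ≥0} (hbc : Continuous b)
    (hcc : Continuous c) (hcb : ∀ x, c (b x) = x) (hb : ∀ x, b (D.phi x) = D.phi (b x))
    (hc : ∀ x, c (D.phi x) = D.phi (c x)) (n : ℕ) :
    (fun x : ℝ => (b x.toNNReal : ℝ) - x) =o[𝓝[≥] 0] fun x : ℝ => x ^ n := by
  -- The bound `b x ≤ phi^[N] x` controls `b x - x` from above. The bound for `c`, applied at the
  -- point `b x`, reads `x ≤ phi^[K] (b x)` and controls it from below. Both error terms are flat.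
  have key : ∀ n, (fun x : ℝ => (b x.toNNReal : ℝ) - x) =O[𝓝[≥] 0] fun x : ℝ => x ^ n := by
    intro n
    obtain ⟨N, hN⟩ := D.exists_le_iterate hbc hb
    obtain ⟨K, hK⟩ := D.exists_le_iterate hcc hc
    have hx1 : ∀ᶠ x : ℝ in 𝓝[≥] 0, x.toNNReal ≤ 1 := by
      filter_upwards [mem_nhdsWithin_of_mem_nhds (Iic_mem_nhds (zero_lt_one' ℝ))] with x hx
      simpa using hx
    have hbO : (fun x : ℝ => (b x.toNNReal : ℝ)) =O[𝓝[≥] 0] fun x : ℝ => x := by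
      refine IsBigO.trans (IsBigO.of_bound 1 ?_) (isBigO_self_of_flat (hD.isBigO_iterate N 1))
      filter_upwards [hx1] with x hx
      simpa using hN _ hx
    have hbT := tendsto_of_isBigO_self hbO fun _ => NNReal.coe_nonneg _
    have h1 := hD.isBigO_iterate N n
    have h2 := isBigO_pow_comp (hD.isBigO_iterate K n) hbT hbO
    refine IsBigO.trans (IsBigO.of_bound 1 ?_) (h1.norm_left.add h2.norm_left)
    filter_upwards [hx1, hbT.eventually hx1] with x hx hbx
    have e1 : (b x.toNNReal : ℝ) ≤ D.phi^[N] x.toNNReal := by exact_mod_cast hN _ hx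
    have e2 : x ≤ D.phi^[K] (b x.toNNReal) := by
      have := hK (b x.toNNReal) (by simpa using hbx)
      rw [hcb] at this
      exact (Real.le_coe_toNNReal x).trans (by exact_mod_cast this)
    simp only [Function.comp_apply, Real.toNNReal_coe, Real.norm_eq_abs, one_mul]
    refine le_trans ?_ (le_abs_self _)
    rw [abs_le]
    have e3 := abs_nonneg ((D.phi^[N] x.toNNReal : ℝ) - x)
    have e4 := abs_nonneg ((D.phi^[K] (b x.toNNReal) : ℝ) - (b x.toNNReal : ℝ))
    have e5 := le_abs_self ((D.phi^[N] x.toNNReal : ℝ) - x)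
    have e6 := le_abs_self ((D.phi^[K] (b x.toNNReal) : ℝ) - (b x.toNNReal : ℝ))
    constructor <;> linarith
  refine (key (n + 1)).trans_isLittleO ?_
  have : (fun x : ℝ => x ^ (n + 1)) =o[𝓝 0] fun x : ℝ => x ^ n :=
    isLittleO_pow_pow (Nat.lt_succ_self n)
  exact this.mono nhdsWithin_le_nhds

/-- A smooth function on the half line that is multiplied by `lam` under a flat `phi` is flat. -/
theorem IsFlat.iteratedDerivWithin_eq_zero_of_equivariant (hD : D.IsFlat) {β : ℝ → ℂ}
    (hβ : ContDiffOn ℝ ∞ β (Ici 0))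
    (h : ∀ x : ℝ≥0, β (D.phi x) = D.lam * β x) (n : ℕ) :
    iteratedDerivWithin n β (Ici 0) 0 = 0 := by
  induction n using Nat.strong_induction_on with
  | _ n ih =>
    set c : ℂ := ((n.factorial : ℝ)⁻¹) • iteratedDerivWithin n β (Ici 0) 0 with hc
    have h1 : (fun x : ℝ => β x - x ^ n • c) =o[𝓝[≥] 0] fun x : ℝ => x ^ n := by
      refine (isLittleO_sub_leading hβ ih).congr_left fun x => ?_
      rw [hc, smul_smul, mul_comm]
    have hO := isBigO_self_of_flat (hD.isBigO 1)
    have hT := tendsto_of_isBigO_self hO fun _ => NNReal.coe_nonneg _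
    have h2 := (h1.comp_tendsto hT).trans_isBigO (hO.pow n)
    -- Replacing `phi x` by `x` in the leading term `x ^ n • c` costs only `o(x ^ n)`: factor out
    -- `phi x - x`, which is `o(x)`, from the difference of powers.
    have h3 : (fun x : ℝ => (D.phi x.toNNReal : ℝ) ^ n - x ^ n) =o[𝓝[≥] 0]
        fun x : ℝ => x ^ n := by
      rcases Nat.eq_zero_or_pos n with rfl | hn
      · simp
      have hsmall : (fun x : ℝ => (D.phi x.toNNReal : ℝ) - x) =o[𝓝[≥] 0] fun x : ℝ => x := by
        simpa using isLittleO_pow_of_iteratedDerivWithin_eq_zero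
          (D.contDiffOn_phi.sub contDiffOn_id) hD 1
      have hsum : (fun x : ℝ => ∑ i ∈ Finset.range n,
          (D.phi x.toNNReal : ℝ) ^ i * x ^ (n - 1 - i)) =O[𝓝[≥] 0] fun x : ℝ => x ^ (n - 1) := by
        refine IsBigO.fun_sum fun i hi => ?_
        refine ((hO.pow i).mul (isBigO_refl (fun x : ℝ => x ^ (n - 1 - i)) _)).congr_right
          fun x => ?_
        rw [← pow_add]
        congr 1
        have := Finset.mem_range.1 hi
        omega
      refine (hsum.mul_isLittleO hsmall).congr (fun x => ?_) fun x => ?_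
      · exact (Commute.all _ _).geom_sum₂_mul n
      · rw [← pow_succ, Nat.sub_add_cancel hn]
    -- Comparing the leading terms on the two sides of `β (phi x) = lam * β x`.
    have h4 : (fun x : ℝ => x ^ n • ((D.lam - 1) * c)) =o[𝓝[≥] 0] fun x : ℝ => x ^ n := by
      have h6 : (fun x : ℝ => ((D.phi x.toNNReal : ℝ) ^ n - x ^ n) • c) =o[𝓝[≥] 0]
          fun x : ℝ => x ^ n := by
        simpa using h3.smul_isBigO
          (isBigO_const_const c (one_ne_zero : (1 : ℝ) ≠ 0) (𝓝[≥] (0 : ℝ)))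
      refine ((h2.sub (h1.const_mul_left D.lam)).add h6).congr' ?_ EventuallyEq.rfl
      filter_upwards [self_mem_nhdsWithin] with x hx
      have := h x.toNNReal
      rw [Real.coe_toNNReal x hx] at this
      simp only [Function.comp_apply, this, Complex.real_smul]
      push_cast
      ring
    have hl : D.lam - 1 ≠ 0 := by
      intro h0
      have := D.one_lt_norm_lam
      rw [sub_eq_zero.1 h0, norm_one] at this
      exact lt_irrefl _ this
    have hc0 : c = 0 := (mul_eq_zero.1 (eq_zero_of_pow_smul_isLittleO h4)).resolve_left hl
    exact (smul_eq_zero.1 hc0).resolve_left (by positivity)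

end HopfData

/-! ### Lifting automorphisms of a Reeb component -/

namespace HopfData

variable (D : HopfData)

/-- The action of `ℤ` on `Cover` generated by the deck transformation. -/
def shift (k : ℤ) (p : Cover) : Cover := ⟨(D.deck ^ k) p.1, D.deck_ne_zero p.2 k⟩

theorem continuous_shift (k : ℤ) : Continuous (D.shift k) :=
  Continuous.subtype_mk ((D.deck ^ k).continuous.comp continuous_subtype_val) _

theorem proj_shift (k : ℤ) (p : Cover) : D.proj (D.shift k p) = D.proj p :=
  (D.proj_eq_iff.2 ⟨k, rfl⟩).symm

theorem shift_one (p : Cover) : (D.shift 1 p).1 = (D.lam * p.1.1, D.phi p.1.2) := by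
  change (D.deck ^ (1 : ℤ)) p.1 = _
  rw [zpow_one]
  rfl

/-- Powers of `T` increase neither coordinate backwards: a positive power fixing `(z, x)` would give
`‖lam * z‖ ≤ ‖z‖` and `phi x ≤ x`, which holds only at the removed origin. -/
theorem eq_zero_of_shift_eq {k : ℤ} {p : Cover} (h : D.shift k p = p) : k = 0 := by
  have key : ∀ n : ℕ, ∀ q : Cover, (D.deck ^ n) (D.deck q.1) ≠ q.1 := by
    rintro n ⟨⟨z, x⟩, hp⟩ h
    have h1 := D.le_deck_pow n (D.deck (z, x))
    simp only at h
    rw [h] at h1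
    obtain ⟨h2, h3⟩ := h1
    change ‖D.lam * z‖ ≤ ‖z‖ at h2
    change D.phi x ≤ x at h3
    have hx : x = 0 := D.eq_zero_of_phi_eq (le_antisymm h3 (D.le_phi x))
    refine hp (Prod.ext ?_ hx)
    by_contra hz
    have : 0 < ‖z‖ := norm_pos_iff.2 hz
    rw [norm_mul] at h2
    nlinarith [D.one_lt_norm_lam]
  have h' : (D.deck ^ k) p.1 = p.1 := congrArg Subtype.val h
  rcases lt_trichotomy k 0 with hk | hk | hk
  · obtain ⟨n, hn⟩ := Int.eq_ofNat_of_zero_le (show 0 ≤ -k - 1 by omega)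
    exfalso
    refine key n p ?_
    nth_rewrite 1 [← h']
    rw [← Homeomorph.mul_apply, ← pow_succ, ← zpow_natCast, ← Homeomorph.mul_apply, ← zpow_add]
    have : ((n + 1 : ℕ) : ℤ) + k = 0 := by push_cast; omega
    rw [this]
    simp
  · exact hk
  · obtain ⟨n, hn⟩ := Int.eq_ofNat_of_zero_le (show 0 ≤ k - 1 by omega)
    exfalso
    refine key n p ?_
    rw [← Homeomorph.mul_apply, ← pow_succ, ← zpow_natCast]
    have : ((n + 1 : ℕ) : ℤ) = k := by push_cast; omega
    rw [this, h']

theorem isCoveringMap_proj : IsCoveringMap D.proj := by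
  let _ : AddAction ℤ Cover :=
    { vadd := D.shift
      zero_vadd := fun p => Subtype.ext rfl
      add_vadd := fun k l p => Subtype.ext (by
        change (D.deck ^ (k + l)) p.1 = (D.deck ^ k) ((D.deck ^ l) p.1)
        rw [zpow_add, Homeomorph.mul_apply]) }
  have h : IsAddQuotientCoveringMap D.proj ℤ :=
    { isQuotientMap_quot_mk with
      continuous_const_vadd := D.continuous_shift
      apply_eq_iff_mem_orbit := by
        intro p q
        rw [eq_comm, D.proj_eq_iff]
        exact ⟨fun ⟨k, hk⟩ => ⟨k, Subtype.ext hk⟩, fun ⟨k, hk⟩ => ⟨k, congrArg Subtype.val hk⟩⟩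
      disjoint := by
        intro p
        obtain ⟨V, hV, hpV, hinj⟩ := D.exists_injOn_proj p
        refine ⟨V, hV.mem_nhds hpV, ?_⟩
        rintro k ⟨_, ⟨q, hq, rfl⟩, hkq⟩
        exact D.eq_zero_of_shift_eq (hinj hkq hq (D.proj_shift k q)) }
  exact h.isCoveringMap

/-- The segment from a point to `(0, 1)` avoids the origin: the height is a sum of nonnegative terms
and vanishes only at time `0` over `x = 0`. -/
instance : ContractibleSpace Cover := by
  rw [contractible_iff_id_nullhomotopic]
  refine ⟨⟨(0, 1), by simp⟩, ⟨⟨⟨fun q => ⟨(((1 - (q.1 : ℝ) : ℝ) : ℂ) * q.2.1.1,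
    (unitInterval.toNNReal (unitInterval.symm q.1)) * q.2.1.2 + unitInterval.toNNReal q.1), ?_⟩,
    ?_⟩, ?_, ?_⟩⟩⟩
  · intro h
    have h1 := congrArg Prod.fst h
    have h2 := congrArg Prod.snd h
    simp only [add_eq_zero] at h2
    have h3 : (q.1 : ℝ) = 0 := congrArg NNReal.toReal h2.2
    have h4 : unitInterval.toNNReal (unitInterval.symm q.1) = 1 := by
      ext
      simp [h3]
    rw [h4, one_mul] at h2
    refine q.2.2 (Prod.ext ?_ h2.1)
    simpa [h3] using h1
  · have := unitInterval.toNNReal_continuous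
    fun_prop
  · rintro ⟨⟨z, x⟩, hp⟩
    ext <;> simp
  · rintro ⟨⟨z, x⟩, hp⟩
    ext <;> simp

instance : LocallyPathConnectedSpace Cover := by
  have h : IsQuotientMap Real.toNNReal :=
    IsQuotientMap.of_inverse NNReal.continuous_coe continuous_real_toNNReal fun _ => Real.toNNReal_coe
  have : LocallyPathConnectedSpace ℝ≥0 := h.locallyPathConnectedSpace
  exact (isOpen_ne (x := ((0 : ℂ), (0 : ℝ≥0)))).locallyPathConnectedSpace

/-- The base point of the boundary leaf. -/
def base : Cover := ⟨(1, 0), by simp⟩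

theorem eq_of_proj_comp_eq {A : Type*} [TopologicalSpace A] [PreconnectedSpace A] {F G : A → Cover}
    (hF : Continuous F) (hG : Continuous G) (h : ∀ a, D.proj (F a) = D.proj (G a)) (a : A)
    (ha : F a = G a) : F = G :=
  D.isCoveringMap_proj.eq_of_comp_eq hF hG (funext h) a ha

/-- The boundary of the cover is the connected set `ℂ ∖ {0}`, on which `F` and the identity are
lifts of the same map that agree at `base`. -/
theorem eq_on_boundary_of_lift {F : Cover → Cover} (hF : Continuous F)
    (h : ∀ p : Cover, p.1.2 = 0 → D.proj (F p) = D.proj p) (hb : F base = base)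
    (p : Cover) (hp : p.1.2 = 0) : F p = p := by
  have hconn : IsPreconnected ({0}ᶜ : Set ℂ) :=
    (isConnected_compl_singleton_of_one_lt_rank (by simp) 0).isPreconnected
  have : PreconnectedSpace ({0}ᶜ : Set ℂ) := isPreconnected_iff_preconnectedSpace.1 hconn
  let i : ({0}ᶜ : Set ℂ) → Cover := fun z => ⟨(z.1, 0), fun h => z.2 (congrArg Prod.fst h)⟩
  have hi : Continuous i :=
    Continuous.subtype_mk (continuous_subtype_val.prodMk continuous_const) _
  have heq : F ∘ i = i := D.eq_of_proj_comp_eq (hF.comp hi) hi (fun a => h _ rfl) ⟨1, by simp⟩ hb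
  obtain ⟨⟨z, x⟩, hzx⟩ := p
  simp only at hp
  subst hp
  exact congrFun heq ⟨z, fun h => hzx (Prod.ext h rfl)⟩

/-- An automorphism of the Reeb component that is the identity on the boundary leaf lifts to a
homeomorphism of the cover that is the identity on the boundary and commutes with the deck
transformation. -/
theorem exists_lift (g : D.Reeb ≃ₜ D.Reeb) (hg : ∀ y ∈ D.boundaryLeaf, g y = y) :
    ∃ F : Cover ≃ₜ Cover, (∀ p, D.proj (F p) = g (D.proj p)) ∧
      (∀ p : Cover, p.1.2 = 0 → F p = p) ∧ ∀ p, F (D.shift 1 p) = D.shift 1 (F p) := by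
  have hbase : D.proj base ∈ D.boundaryLeaf := ⟨base, rfl, rfl⟩
  have lift : ∀ g : D.Reeb ≃ₜ D.Reeb, (∀ y ∈ D.boundaryLeaf, g y = y) →
      ∃ F : C(Cover, Cover), F base = base ∧ ∀ p, D.proj (F p) = g (D.proj p) := by
    intro g hg
    obtain ⟨F, ⟨h1, h2⟩, -⟩ := D.isCoveringMap_proj.existsUnique_continuousMap_lifts
      (⟨g ∘ D.proj, g.continuous.comp D.continuous_proj⟩ : C(Cover, D.Reeb)) base base
      (hg _ hbase).symm
    exact ⟨F, h1, fun p => congrFun h2 p⟩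
  have hg' : ∀ y ∈ D.boundaryLeaf, g.symm y = y := fun y hy => by
    rw [Homeomorph.symm_apply_eq, hg y hy]
  obtain ⟨F, hF1, hF2⟩ := lift g hg
  obtain ⟨G, hG1, hG2⟩ := lift g.symm hg'
  have hGF : G ∘ F = id := D.eq_of_proj_comp_eq (G.continuous.comp F.continuous) continuous_id
    (fun p => by simp [hF2, hG2]) base (by simp [hF1, hG1])
  have hFG : F ∘ G = id := D.eq_of_proj_comp_eq (F.continuous.comp G.continuous) continuous_id
    (fun p => by simp [hF2, hG2]) base (by simp [hF1, hG1])
  have hbd : ∀ p : Cover, p.1.2 = 0 → F p = p :=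
    D.eq_on_boundary_of_lift F.continuous
      (fun p hp => by rw [hF2, hg _ ⟨p, hp, rfl⟩]) hF1
  refine ⟨⟨⟨F, G, congrFun hGF, congrFun hFG⟩, F.continuous, G.continuous⟩, hF2, hbd, ?_⟩
  -- Both composites lift the same map, since `proj` does not see `shift`. They agree at `base`
  -- because `T` maps the boundary to itself, where `F` is the identity.
  refine congrFun (D.eq_of_proj_comp_eq (F := F ∘ D.shift 1) (G := D.shift 1 ∘ F)
    (F.continuous.comp (D.continuous_shift 1)) ((D.continuous_shift 1).comp F.continuous)
    (fun p => by simp [hF2, D.proj_shift]) base ?_)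
  simp only [Function.comp_apply, hF1]
  exact hbd _ (by rw [D.shift_one]; exact D.phi_zero)

end HopfData

/-! ### Entire functions of linear growth -/

/-- Cauchy's estimate bounds the derivative, which is then constant by Liouville. -/
theorem eq_affine_of_linear_growth {f : ℂ → ℂ} (hf : Differentiable ℂ f) {C : ℝ}
    (hC : ∀ z, 1 ≤ ‖z‖ → ‖f z‖ ≤ C * ‖z‖) : ∃ a b, ∀ z, f z = a * z + b := by
  have hC0 : 0 ≤ C := by simpa using (norm_nonneg _).trans (hC 1 (by simp))
  have hd : Differentiable ℂ (deriv f) := by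
    rw [← differentiableOn_univ]
    exact hf.differentiableOn.deriv isOpen_univ
  have hb : ∀ z, ‖deriv f z‖ ≤ 2 * C := by
    intro z
    -- On the circle of radius `‖z‖ + 2` about `z` one has `‖w‖ ≥ 2`, so the growth bound applies,
    -- and `‖w‖` is at most twice the radius, whence the bound `2 * C`.
    have hR : 0 < ‖z‖ + 2 := by positivity
    have := Complex.norm_deriv_le_of_forall_mem_sphere_norm_le (f := f) (c := z)
      (C := C * (2 * (‖z‖ + 2))) hR hf.diffContOnCl ?_
    · refine this.trans (le_of_eq ?_)
      field_simp
    · intro w hw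
      rw [mem_sphere_iff_norm] at hw
      have h1 : ‖w - z‖ ≤ ‖w‖ + ‖z‖ := norm_sub_le _ _
      have h2 : ‖w‖ ≤ ‖w - z‖ + ‖z‖ := by simpa using norm_add_le (w - z) z
      refine (hC w (by linarith)).trans ?_
      gcongr
      linarith [norm_nonneg z]
  have hconst : ∀ z, deriv f z = deriv f 0 := fun z => by
    refine hd.apply_eq_apply_of_bounded ?_ z 0
    exact isBounded_iff_forall_norm_le.2 ⟨2 * C, by rintro _ ⟨z, rfl⟩; exact hb z⟩
  refine ⟨deriv f 0, f 0, fun z => ?_⟩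
  have hg : ∀ z, HasDerivAt (fun z => f z - deriv f 0 * z) 0 z := fun z => by
    have := (hf z).hasDerivAt.sub ((hasDerivAt_id z).const_mul (deriv f 0))
    rw [hconst z, mul_one, sub_self] at this
    exact this
  have := is_const_of_deriv_eq_zero (fun z => (hg z).differentiableAt) (fun z => (hg z).deriv) z 0
  simp only [mul_zero, sub_zero] at this
  rw [← this]
  ring

/-! ### The normal form of automorphisms of a Reeb component -/

theorem leafwisePregroupoid_mono {X : Type*} [TopologicalSpace X]
    (I : ModelWithCorners ℝ (ℂ × ℝ) (ℂ × X)) {f : ℂ × X → ℂ × X} {s t : Set (ℂ × X)}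
    (h : (leafwisePregroupoid I).property f s) (hts : t ⊆ s) :
    (leafwisePregroupoid I).property f t := by
  refine ⟨?_, fun p hp => h.2 p (hts hp)⟩
  have := h.1
  rw [contDiffPregroupoid] at this ⊢
  exact this.mono (inter_subset_inter_left _ (preimage_mono hts))

theorem isOpen_ne_zero : IsOpen {p : ℂ × ℝ≥0 | p ≠ (0, 0)} := isOpen_ne

namespace HopfData

variable (D : HopfData)

/-- The extension by the identity at `(0, 0)` of a self-map of the cover. -/
def total (F : Cover → Cover) (p : ℂ × ℝ≥0) : ℂ × ℝ≥0 := by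
  classical exact if h : p ≠ (0, 0) then (F ⟨p, h⟩).1 else p

theorem total_of_ne (F : Cover → Cover) {p : ℂ × ℝ≥0} (h : p ≠ (0, 0)) :
    total F p = (F ⟨p, h⟩).1 := dif_pos h

theorem continuousOn_total {F : Cover → Cover} (hF : Continuous F) :
    ContinuousOn (total F) {p | p ≠ (0, 0)} := by
  rw [continuousOn_iff_continuous_domRestrict]
  refine (continuous_subtype_val.comp hF).congr fun p => ?_
  rw [domRestrict_apply, total_of_ne F p.2]
  rfl

/-- A chart around `proj p` has some translate of `p` in its target; composing with a deck
transformation moves it to `p`. Hence a lift can be read directly as a coordinate expression. -/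
theorem exists_chart_target (p : Cover) : ∃ e ∈ D.reebAtlas, p.1 ∈ e.target := by
  obtain ⟨e, he, hp⟩ := D.exists_chart (D.proj p)
  obtain ⟨h0, h1⟩ := he _ (e.map_source hp)
  rw [e.left_inv hp] at h1
  obtain ⟨k, hk⟩ := D.proj_eq_iff.1 h1
  refine ⟨e.transHomeomorph (D.deck ^ k).symm, ?_, ?_⟩
  · intro q hq
    obtain ⟨h2, h3⟩ := he ((D.deck ^ k) q) hq
    have hq0 : q ≠ (0, 0) := by
      rintro rfl
      have h4 := D.deck_ne_zero h2 (-k)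
      rw [← Homeomorph.mul_apply, ← zpow_add, neg_add_cancel, zpow_zero] at h4
      exact h4 rfl
    refine ⟨hq0, ?_⟩
    change e.symm ((D.deck ^ k) q) = _
    rw [h3]
    exact D.proj_shift k ⟨q, hq0⟩
  · change (D.deck ^ k) p.1 ∈ e.target
    rw [hk]
    exact e.map_source hp

variable {D}

theorem property_total {g : D.Reeb ≃ₜ D.Reeb} (hg : g ∈ aut folBdry D.Reeb) {F : Cover → Cover}
    (hF : Continuous F) (hgF : ∀ p, D.proj (F p) = g (D.proj p)) :
    (leafwisePregroupoid halfModel).property (total F) {p | p ≠ (0, 0)} := by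
  refine (leafwisePregroupoid halfModel).locality isOpen_ne_zero fun p hp => ?_
  obtain ⟨e, he, hpe⟩ := D.exists_chart_target ⟨p, hp⟩
  obtain ⟨e', he', hpe'⟩ := D.exists_chart_target (F ⟨p, hp⟩)
  have hV := (continuousOn_total hF).isOpen_inter_preimage isOpen_ne_zero e'.open_target
  refine ⟨_, e.open_target.inter hV, ⟨hpe, hp, ?_⟩, ?_⟩
  · rw [mem_preimage, total_of_ne F hp]
    exact hpe'
  have hmem := hg e e' he he'
  have key : ∀ q ∈ e.target ∩ ({p | p ≠ (0, 0)} ∩ total F ⁻¹' e'.target),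
      g (e.symm q) = e'.symm (total F q) := by
    rintro q ⟨hq1, hq2, hq3⟩
    obtain ⟨_, h1⟩ := he q hq1
    obtain ⟨_, h2⟩ := he' _ hq3
    rw [h1, ← hgF, h2]
    congr 1
    exact Subtype.ext (total_of_ne F hq2).symm
  refine (leafwisePregroupoid halfModel).congr
    (isOpen_ne_zero.inter (e.open_target.inter hV)) (g := total F) (fun q hq => ?_)
    (leafwisePregroupoid_mono halfModel hmem.1 fun q hq => ?_)
  · change _ = e' (g (e.symm q))
    rw [key q hq.2]
    exact (e'.right_inv hq.2.2.2).symm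
  · refine ⟨hq.2.1, mem_univ _, ?_⟩
    change g (e.symm q) ∈ e'.source
    rw [key q hq.2]
    exact e'.map_target hq.2.2.2

/-- On the compact set `1 ≤ ‖z‖ ≤ ‖lam‖`, `x ≤ X` there is a constant bound. Any other point is
reached from it by powers of `T`, which scale both `z` and the first coordinate of `F` by `lam`;
pulling back by `T` lowers `x`, so the condition `x ≤ X` is kept. -/
theorem exists_linear_growth {F : Cover → Cover} (hF : Continuous F)
    (hcomm : ∀ p, F (D.shift 1 p) = D.shift 1 (F p)) (X : ℝ≥0) :
    ∃ C : ℝ, ∀ p : Cover, 1 ≤ ‖p.1.1‖ → p.1.2 ≤ X → ‖(F p).1.1‖ ≤ C * ‖p.1.1‖ := by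
  set K : Set (ℂ × ℝ≥0) := ((fun z : ℂ => ‖z‖) ⁻¹' Ici 1 ∩ Metric.closedBall 0 ‖D.lam‖) ×ˢ
    Icc 0 X with hK
  have hKc : IsCompact K := by
    refine IsCompact.prod ?_ isCompact_Icc
    exact (isCompact_closedBall _ _).inter_left (isClosed_Ici.preimage continuous_norm)
  have hK0 : K ⊆ {p | p ≠ (0, 0)} := by
    rintro ⟨z, x⟩ hp h
    have h1 : (1 : ℝ) ≤ ‖z‖ := hp.1.1
    have h2 : z = 0 := congrArg Prod.fst h
    rw [h2, norm_zero] at h1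
    linarith
  obtain ⟨C, hC⟩ := (hKc.image_of_continuousOn
    (continuous_fst.comp_continuousOn ((continuousOn_total hF).mono hK0))).isBounded.exists_norm_le
  have hC' : ∀ p : Cover, 1 ≤ ‖p.1.1‖ → ‖p.1.1‖ ≤ ‖D.lam‖ → p.1.2 ≤ X → ‖(F p).1.1‖ ≤ C := by
    intro p h1 h2 h3
    have := hC _ (mem_image_of_mem _
      (show p.1 ∈ K from ⟨⟨h1, by simpa using h2⟩, zero_le, h3⟩))
    simpa [total_of_ne F p.2] using this
  have hl := D.one_lt_norm_lam
  have hC0 : 0 ≤ C := (norm_nonneg _).trans (hC' ⟨(1, 0), by simp⟩ (by simp) (by simpa using hl.le)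
    zero_le)
  refine ⟨C, fun p => ?_⟩
  obtain ⟨n, hn⟩ := pow_unbounded_of_one_lt ‖p.1.1‖ hl
  replace hn := hn.le
  induction n generalizing p with
  | zero =>
    intro h1 h2
    refine (hC' p h1 ?_ h2).trans (le_mul_of_one_le_right hC0 h1)
    rw [pow_zero] at hn
    exact hn.trans hl.le
  | succ n ih =>
    intro h1 h2
    rcases le_total ‖p.1.1‖ ‖D.lam‖ with h3 | h3
    · exact (hC' p h1 h3 h2).trans (le_mul_of_one_le_right hC0 h1)
    have hl0 : 0 < ‖D.lam‖ := one_pos.trans hl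
    have hz : D.lam⁻¹ * p.1.1 ≠ 0 := mul_ne_zero (inv_ne_zero D.lam_ne_zero)
      (norm_pos_iff.1 (one_pos.trans_le h1))
    let q : Cover := ⟨(D.lam⁻¹ * p.1.1, D.phi.symm p.1.2), fun h => hz (congrArg Prod.fst h)⟩
    have hq : D.shift 1 q = p := by
      refine Subtype.ext ?_
      rw [D.shift_one]
      simp [q, D.lam_ne_zero]
    have hqn : ‖q.1.1‖ = ‖p.1.1‖ / ‖D.lam‖ := by
      simp only [q, norm_mul, norm_inv]
      rw [div_eq_inv_mul]
    have h4 := ih q ?_ ?_ ?_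
    · rw [← hq, hcomm, D.shift_one, D.shift_one, norm_mul, norm_mul]
      nlinarith
    · rw [hqn, div_le_iff₀ hl0, ← pow_succ]
      exact hn
    · rw [hqn, le_div_iff₀ hl0, one_mul]
      exact h3
    · refine le_trans ?_ h2
      change D.phi.symm p.1.2 ≤ _
      rw [D.phi.symm_apply_le]
      exact D.le_phi _

theorem exists_affine_form {F : Cover → Cover} (hF : Continuous F)
    (hprop : (leafwisePregroupoid halfModel).property (total F) {p | p ≠ (0, 0)})
    (hbd : ∀ p : Cover, p.1.2 = 0 → F p = p)
    (hcomm : ∀ p, F (D.shift 1 p) = D.shift 1 (F p)) :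
    ∃ (β : ℝ≥0 → ℂ) (b : ℝ≥0 → ℝ≥0), (∀ p : Cover, (F p).1 = (p.1.1 + β p.1.2, b p.1.2)) ∧
      Continuous b ∧ (∀ x, β (D.phi x) = D.lam * β x) ∧ (∀ x, b (D.phi x) = D.phi (b x)) ∧
      ContDiffOn ℝ ∞ (fun x : ℝ => β x.toNNReal) (Ici 0) ∧
      ContDiffOn ℝ ∞ (fun x : ℝ => (b x.toNNReal : ℝ)) (Ici 0) := by
  have hne : ∀ {z : ℂ} (x : ℝ≥0), z ≠ 0 → (z, x) ≠ (0, 0) := fun x hz h => hz (congrArg Prod.fst h)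
  have hne' : ∀ (z : ℂ) {x : ℝ≥0}, x ≠ 0 → (z, x) ≠ (0, 0) :=
    fun z x hx h => hx (congrArg Prod.snd h)
  have hcont : ∀ z : ℂ, z ≠ 0 → Continuous fun x : ℝ≥0 => total F (z, x) := fun z hz =>
    (continuousOn_total hF).comp_continuous (by fun_prop) fun x => hne x hz
  have hsmooth : ∀ z : ℂ, z ≠ 0 → ContDiffOn ℝ ∞
      (fun x : ℝ => halfModel (total F (z, x.toNNReal))) (Ici 0) := by
    intro z hz
    have h1 := hprop.1
    rw [contDiffPregroupoid] at h1
    refine ContDiffOn.comp (g := halfModel ∘ total F ∘ halfModel.symm) (f := fun x : ℝ => (z, x))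
      h1 (contDiff_const.prodMk contDiff_id).contDiffOn fun x hx => ⟨hne _ hz, ?_⟩
    exact ⟨(z, x.toNNReal), Prod.ext rfl (Real.coe_toNNReal x hx)⟩
  set a : ℝ≥0 → ℂ → ℂ := fun x z => (total F (z, x)).1 with ha
  set b : ℝ≥0 → ℝ≥0 := fun x => (total F (1, x)).2 with hb
  have hsnd : ∀ p : Cover, (F p).1.2 = b p.1.2 := by
    rintro ⟨⟨z, x⟩, hp⟩
    rcases eq_or_ne x 0 with rfl | hx
    · rw [hbd _ rfl]
      simp only [hb]
      rw [total_of_ne F (hne 0 one_ne_zero), hbd _ rfl]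
    · have hloc : IsLocallyConstant fun z : ℂ => (total F (z, x)).2 :=
        (IsLocallyConstant.iff_eventually_eq _).2 fun z => (hprop.2 (z, x) (hne' z hx)).1
      have := hloc.apply_eq_of_preconnectedSpace z 1
      rw [total_of_ne F hp] at this
      exact this
  -- Liouville is applied only on the leaves `x > 0`, which are full copies of `ℂ`; on the punctured
  -- leaf `x = 0` the form is known from `hbd`.
  have haff : ∀ x, ∃ α β : ℂ, ∀ z, (z, x) ≠ (0, 0) → a x z = α * z + β := by
    intro x
    rcases eq_or_ne x 0 with rfl | hx
    · refine ⟨1, 0, fun z hz => ?_⟩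
      simp only [ha]
      rw [total_of_ne F hz, hbd _ rfl, one_mul, add_zero]
    · obtain ⟨C, hC⟩ := exists_linear_growth hF hcomm x
      obtain ⟨α, β, h⟩ := eq_affine_of_linear_growth (f := a x)
        (fun z => (hprop.2 (z, x) (hne' z hx)).2) (C := C) fun z hz => by
          simp only [ha]
          rw [total_of_ne F (hne' z hx)]
          exact hC ⟨(z, x), hne' z hx⟩ hz le_rfl
      exact ⟨α, β, fun z _ => h z⟩
  choose α β haff using haff
  -- The coefficients are recovered from the values at `z = 1` and `z = 2`. Unlike `z = 0`, these
  -- points stay in the cover at `x = 0`, so regularity holds up to the boundary.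
  have h1 : ∀ x, a x 1 = α x + β x := fun x => by rw [haff x 1 (hne x one_ne_zero), mul_one]
  have h2 : ∀ x, a x 2 = 2 * α x + β x := fun x => by
    rw [haff x 2 (hne x two_ne_zero), mul_comm]
  have heq : ∀ x z, z ≠ 0 →
      total F (D.lam * z, D.phi x) = (D.lam * (total F (z, x)).1, D.phi (total F (z, x)).2) := by
    intro x z hz
    have := hcomm ⟨(z, x), hne x hz⟩
    rw [total_of_ne F (hne x hz), total_of_ne F (hne _ (mul_ne_zero D.lam_ne_zero hz)),
      ← D.shift_one, ← this]
    congr 2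
  have heqa : ∀ x z, z ≠ 0 → α (D.phi x) * (D.lam * z) + β (D.phi x) =
      D.lam * (α x * z + β x) := by
    intro x z hz
    rw [← haff _ _ (hne _ (mul_ne_zero D.lam_ne_zero hz)), ← haff _ _ (hne x hz)]
    exact congrArg Prod.fst (heq x z hz)
  have hα : ∀ x, α (D.phi x) = α x := fun x => by
    have e1 := heqa x 1 one_ne_zero
    have e2 := heqa x 2 two_ne_zero
    refine mul_left_cancel₀ D.lam_ne_zero ?_
    linear_combination e2 - e1
  have hβ : ∀ x, β (D.phi x) = D.lam * β x := fun x => by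
    have e1 := heqa x 1 one_ne_zero
    rw [hα] at e1
    linear_combination e1
  have hαc : Continuous α := by
    have : α = fun x => a x 2 - a x 1 := funext fun x => by rw [h1, h2]; ring
    rw [this]
    exact (continuous_fst.comp (hcont 2 two_ne_zero)).sub (continuous_fst.comp (hcont 1 one_ne_zero))
  have hα0 : α 0 = 1 := by
    have e1 : a 0 1 = 1 := by
      simp only [ha]
      rw [total_of_ne F (hne 0 one_ne_zero), hbd _ rfl]
    have e2 : a 0 2 = 2 := by
      simp only [ha]
      rw [total_of_ne F (hne 0 two_ne_zero), hbd _ rfl]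
    rw [h1] at e1
    rw [h2] at e2
    linear_combination e2 - e1
  -- `α` is constant along the backward orbit of `x`, which tends to `0`, where `α` is `1`.
  have hα1 : ∀ x, α x = 1 := by
    intro x
    have e1 : ∀ n : ℕ, α (D.phi.symm^[n] x) = α x := by
      intro n
      induction n with
      | zero => rfl
      | succ n ih => rw [Function.iterate_succ_apply', ← ih, ← hα, D.phi.apply_symm_apply]
    have e2 := (hαc.tendsto 0).comp (D.tendsto_phi_symm_iterate x)
    simp only [Function.comp_def, e1, hα0] at e2
    exact tendsto_nhds_unique tendsto_const_nhds e2
  refine ⟨β, b, fun p => Prod.ext ?_ (hsnd p), continuous_snd.comp (hcont 1 one_ne_zero), hβ,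
    fun x => ?_, ?_, ?_⟩
  · have := haff p.1.2 p.1.1 p.2
    rw [hα1, one_mul] at this
    rw [← this]
    simp only [ha]
    rw [total_of_ne F p.2]
  · have := hsnd (D.shift 1 ⟨(1, x), hne x one_ne_zero⟩)
    rw [hcomm, D.shift_one, D.shift_one, hsnd] at this
    exact this.symm
  · have e1 := (hsmooth 1 one_ne_zero).fst
    have e2 := (hsmooth 2 two_ne_zero).fst
    refine ((contDiffOn_const (c := (2 : ℂ))).mul e1 |>.sub e2).congr fun x _ => ?_
    change _ = 2 * a x.toNNReal 1 - a x.toNNReal 2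
    rw [h1, h2]
    ring
  · exact (hsmooth 1 one_ne_zero).snd

theorem point_eq {z : ℂ} {x : ℝ≥0} (h : (z, x) ≠ (0, 0)) : D.point z x = D.proj ⟨(z, x), h⟩ := by
  unfold point
  simp only [Real.toNNReal_coe]
  exact dif_pos h

theorem contDiff_indicator_toNNReal {E : Type*} [NormedAddCommGroup E] [NormedSpace ℝ E]
    {f : ℝ≥0 → E} (hf : ContDiffOn ℝ ∞ (fun x : ℝ => f x.toNNReal) (Ici 0))
    (h : ∀ n, iteratedDerivWithin n (fun x : ℝ => f x.toNNReal) (Ici 0) 0 = 0) :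
    ∃ f' : ℝ → E, ContDiff ℝ ∞ f' ∧ (∀ x : ℝ≥0, f' x = f x) ∧ ∀ x ≤ 0, f' x = 0 := by
  have h0 : f 0 = 0 := by simpa using h 0
  refine ⟨_, contDiff_indicator_Ici hf h, fun x => ?_, fun x hx => ?_⟩
  · rw [indicator_of_mem (show (x : ℝ) ∈ Ici 0 from x.2), Real.toNNReal_coe]
  · rcases eq_or_lt_of_le hx with rfl | hx
    · rw [indicator_of_mem self_mem_Ici, Real.toNNReal_zero, h0]
    · exact indicator_of_notMem (by simpa using hx) _

/-- If `phi` is flat then the automorphisms of the Reeb component that are the identity on the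
boundary leaf are given by `(z, x) ↦ (z + β x, b x)`, where `β` and `b` extend smoothly to negative
`x` by `0` and the identity. -/
theorem IsFlat.exists_normal_form (hD : D.IsFlat) {g : D.Reeb ≃ₜ D.Reeb} (hg : g ∈ D.autRel) :
    ∃ (β : ℝ → ℂ) (b c : ℝ → ℝ), ContDiff ℝ ∞ β ∧ ContDiff ℝ ∞ b ∧ ContDiff ℝ ∞ c ∧
      Function.LeftInverse c b ∧ Function.RightInverse c b ∧ (∀ x ≤ 0, β x = 0) ∧
      (∀ x ≤ 0, b x = x) ∧ (∀ x, 0 < x → 0 < b x) ∧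
      ∀ (z : ℂ) (x : ℝ), 0 ≤ x → (z ≠ 0 ∨ 0 < x) →
        g (D.point z x) = D.point (z + β x) (b x) := by
  obtain ⟨F, hF1, hF2, hF3⟩ := D.exists_lift g hg.2
  have hG1 : ∀ p, D.proj (F.symm p) = g⁻¹ (D.proj p) := fun p => by
    rw [Homeomorph.inv_apply, Homeomorph.eq_symm_apply, ← hF1, F.apply_symm_apply]
  have hG2 : ∀ p : Cover, p.1.2 = 0 → F.symm p = p := fun p hp => by
    rw [Homeomorph.symm_apply_eq, hF2 p hp]
  have hG3 : ∀ p, F.symm (D.shift 1 p) = D.shift 1 (F.symm p) := fun p => by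
    rw [Homeomorph.symm_apply_eq, hF3, F.apply_symm_apply]
  obtain ⟨β, b, hFb, hbc, hβφ, hbφ, hβs, hbs⟩ :=
    exists_affine_form F.continuous (property_total hg.1 F.continuous hF1) hF2 hF3
  -- The inverse lift supplies a smooth inverse `c` of `b`; its translation part is not needed,
  -- being determined by `β` and `c`.
  obtain ⟨γ, c, hGc, hcc, -, hcφ, -, hcs⟩ :=
    exists_affine_form F.symm.continuous
      (property_total ((aut folBdry D.Reeb).inv_mem hg.1) F.symm.continuous hG1) hG2 hG3
  have hne : ∀ x : ℝ≥0, ((1 : ℂ), x) ≠ (0, 0) := fun x h => one_ne_zero (congrArg Prod.fst h)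
  have hcb : ∀ x, c (b x) = x := fun x => by
    have h1 := congrArg Prod.snd (hGc (F ⟨(1, x), hne x⟩))
    rw [F.symm_apply_apply, hFb] at h1
    exact h1.symm
  have hbc' : ∀ x, b (c x) = x := fun x => by
    have h1 := congrArg Prod.snd (hFb (F.symm ⟨(1, x), hne x⟩))
    rw [F.apply_symm_apply, hGc] at h1
    exact h1.symm
  have hb0 : b 0 = 0 := by
    have h1 := congrArg Prod.snd (hFb ⟨(1, 0), hne 0⟩)
    rw [hF2 _ rfl] at h1
    exact h1.symm
  have extend : ∀ b c : ℝ≥0 → ℝ≥0, Continuous b → Continuous c → (∀ x, c (b x) = x) →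
      (∀ x, b (D.phi x) = D.phi (b x)) → (∀ x, c (D.phi x) = D.phi (c x)) →
      ContDiffOn ℝ ∞ (fun x : ℝ => (b x.toNNReal : ℝ)) (Ici 0) →
      ∃ b' : ℝ → ℝ, ContDiff ℝ ∞ b' ∧ (∀ x : ℝ≥0, b' x = b x) ∧ ∀ x ≤ 0, b' x = x := by
    intro b c hbc hcc hcb hbφ hcφ hbs
    have hcongr : EqOn (fun x : ℝ => (b x.toNNReal : ℝ) - x)
        (fun x : ℝ => (b x.toNNReal : ℝ) - (x.toNNReal : ℝ)) (Ici 0) := fun x hx => by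
      simp only [Real.coe_toNNReal x hx]
    have hs := (hbs.sub contDiffOn_id).congr hcongr.symm
    -- The flat function is `b x - x`; extending it by zero extends `b` by the identity.
    obtain ⟨f, hf1, hf2, hf3⟩ := contDiff_indicator_toNNReal (f := fun x => (b x : ℝ) - x) hs
      (iteratedDerivWithin_eq_zero_of_isLittleO hs fun n =>
        (hD.isLittleO_of_comm hbc hcc hcb hbφ hcφ n).congr'
          (hcongr.eventuallyEq_of_mem self_mem_nhdsWithin) EventuallyEq.rfl)
    refine ⟨fun x => x + f x, contDiff_id.add hf1, fun x => ?_, fun x hx => ?_⟩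
    · simp [hf2]
    · simp [hf3 x hx]
  obtain ⟨b', hb1, hb2, hb3⟩ := extend b c hbc hcc hcb hbφ hcφ hbs
  obtain ⟨c', hc1, hc2, hc3⟩ := extend c b hcc hbc hbc' hcφ hbφ hcs
  obtain ⟨β', hβ1, hβ2, hβ3⟩ := contDiff_indicator_toNNReal hβs
    (hD.iteratedDerivWithin_eq_zero_of_equivariant hβs fun x => by simpa using hβφ x)
  refine ⟨β', b', c', hβ1, hb1, hc1, fun x => ?_, fun x => ?_, hβ3, hb3, fun x hx => ?_, ?_⟩
  · rcases le_total 0 x with hx | hx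
    · lift x to ℝ≥0 using hx
      rw [hb2, hc2, hcb]
    · rw [hb3 x hx, hc3 x hx]
  · rcases le_total 0 x with hx | hx
    · lift x to ℝ≥0 using hx
      rw [hc2, hb2, hbc']
    · rw [hc3 x hx, hb3 x hx]
  · lift x to ℝ≥0 using hx.le
    rw [hb2]
    refine NNReal.coe_pos.2 (pos_iff_ne_zero.2 fun h => hx.ne' ?_)
    rw [← hcb x, h, ← hb0, hcb, NNReal.coe_zero]
  · intro z x hx hzx
    lift x to ℝ≥0 using hx
    have hp : (z, x) ≠ (0, 0) := by
      intro h
      have h1 : z = 0 := congrArg Prod.fst h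
      have h2 : x = 0 := congrArg Prod.snd h
      simp [h1, h2] at hzx
    have hq : (z + β x, b x) ≠ (0, 0) := by
      rw [← hFb ⟨(z, x), hp⟩]
      exact (F _).2
    rw [point_eq hp, ← hF1, hβ2, hb2, point_eq hq]
    congr 1
    exact Subtype.ext (hFb _)

end HopfData

/-! ### Local isomorphisms -/

instance {X : Type*} [TopologicalSpace X] (I : ModelWithCorners ℝ (ℂ × ℝ) (ℂ × X)) :
    ClosedUnderRestriction (leafwiseGroupoid I) where
  closedUnderRestriction he _ _ :=
    ⟨leafwisePregroupoid_mono I he.1 inter_subset_left,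
      leafwisePregroupoid_mono I he.2 inter_subset_left⟩

instance : ClosedUnderRestriction fol :=
  inferInstanceAs (ClosedUnderRestriction (leafwiseGroupoid 𝓘(ℝ, ℂ × ℝ)))

section LocalIso

variable {M N : Type*} [TopologicalSpace M] [TopologicalSpace N] [ChartedSpace (ℂ × ℝ) M]
  [ChartedSpace (ℂ × ℝ) N]

theorem IsLocalIsoOn.continuousOn {f : M → N} {s : Set M} (hf : IsLocalIsoOn f s) :
    ContinuousOn f s := fun x hx => (hf x hx).continuousWithinAt

/-- A local isomorphism agrees, near every point, with an open partial homeomorphism that belongs to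
the pseudogroup in charts. -/
theorem IsLocalIsoOn.exists_eqOn {f : M → N} {s : Set M} (hf : IsLocalIsoOn f s) {y : M}
    (hs : s ∈ 𝓝 y) : ∃ e ∈ fol, ∃ O : Set M, IsOpen O ∧ y ∈ O ∧ O ⊆ s ∧
      O ⊆ (chartAt (ℂ × ℝ) y ≫ₕ e ≫ₕ (chartAt (ℂ × ℝ) (f y)).symm).source ∧
      EqOn f (chartAt (ℂ × ℝ) y ≫ₕ e ≫ₕ (chartAt (ℂ × ℝ) (f y)).symm) O := by
  obtain ⟨e, he, heq, hy⟩ := (hf y (mem_of_mem_nhds hs)).prop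
    (by
      rw [mem_preimage, (chartAt (ℂ × ℝ) y).left_inv (mem_chart_source _ y)]
      exact mem_of_mem_nhds hs)
  set χ := chartAt (ℂ × ℝ) y
  set χ' := chartAt (ℂ × ℝ) (f y)
  have hint : IsOpen (interior s ∩ f ⁻¹' χ'.source) :=
    (hf.continuousOn.mono interior_subset).isOpen_inter_preimage isOpen_interior χ'.open_source
  have hχ : IsOpen (χ.source ∩ χ ⁻¹' e.source) := χ.isOpen_inter_preimage e.open_source
  have hval : ∀ p ∈ (interior s ∩ f ⁻¹' χ'.source) ∩ (χ.source ∩ χ ⁻¹' e.source),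
      e (χ p) = χ' (f p) := by
    rintro p ⟨⟨h1, -⟩, h3, h4⟩
    have := heq (x := χ p) ⟨by rw [mem_preimage, χ.left_inv h3]; exact interior_subset h1, h4⟩
    simp only [Function.comp_apply, χ.left_inv h3] at this
    exact this.symm
  refine ⟨e, he, _, hint.inter hχ, ⟨⟨mem_interior_iff_mem_nhds.2 hs, mem_chart_source _ (f y)⟩,
    mem_chart_source _ y, hy⟩, fun p hp => interior_subset hp.1.1, fun p hp => ?_, fun p hp => ?_⟩
  · refine ⟨hp.2.1, hp.2.2, ?_⟩
    change e (χ p) ∈ χ'.target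
    rw [hval p hp]
    exact χ'.map_source hp.1.2
  · change f p = χ'.symm (e (χ p))
    rw [hval p hp, χ'.left_inv hp.1.2]

/-- The image of an open set under a local isomorphism is open. -/
theorem IsLocalIsoOn.isOpen_image {f : M → N} {s : Set M} (hf : IsLocalIsoOn f s)
    (hs : IsOpen s) : IsOpen (f '' s) := by
  rw [isOpen_iff_mem_nhds]
  rintro _ ⟨y, hy, rfl⟩
  obtain ⟨e, -, O, hO, hyO, hOs, hOsrc, heq⟩ := hf.exists_eqOn (hs.mem_nhds hy)
  have h1 := OpenPartialHomeomorph.isOpen_image_of_subset_source _ hO hOsrc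
  rw [← heq.image_eq] at h1
  exact mem_of_superset (h1.mem_nhds (mem_image_of_mem f hyO)) (image_mono hOs)

/-- `F` agrees near `m`, in foliated charts, with an element of the pseudogroup. -/
def IsLeafwiseAt (F : N → N) (m : N) : Prop :=
  ∃ κ ∈ fol.maximalAtlas N, ∃ κ' ∈ fol.maximalAtlas N, ∃ Φ ∈ fol,
    ∀ᶠ q in 𝓝 m, q ∈ (κ ≫ₕ Φ ≫ₕ κ'.symm).source ∧ F q = (κ ≫ₕ Φ ≫ₕ κ'.symm) q

theorem IsLeafwiseAt.continuousAt {F : N → N} {m : N} (h : IsLeafwiseAt F m) :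
    ContinuousAt F m := by
  obtain ⟨κ, -, κ', -, Φ, -, h⟩ := h
  exact ((κ ≫ₕ Φ ≫ₕ κ'.symm).continuousAt h.self_of_nhds.1).congr
    (h.mono fun q hq => hq.2.symm)

variable [HasGroupoid N fol]

/-- A local isomorphism from the model is, near every point, the inverse of a foliated chart. -/
theorem IsLocalIsoOn.exists_chart {f : ℂ × ℝ → N} {s : Set (ℂ × ℝ)} (hf : IsLocalIsoOn f s)
    {p : ℂ × ℝ} (hs : s ∈ 𝓝 p) : ∃ κ ∈ fol.maximalAtlas N, p ∈ κ.target ∧ κ.target ⊆ s ∧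
      EqOn f κ.symm κ.target := by
  obtain ⟨e, he, O, hO, hyO, hOs, hOsrc, heq⟩ := hf.exists_eqOn hs
  rw [chartAt_self_eq, OpenPartialHomeomorph.refl_trans] at hOsrc heq
  set χ := chartAt (ℂ × ℝ) (f p)
  have hsrc : ((e ≫ₕ χ.symm).restr O).source = O := by
    rw [OpenPartialHomeomorph.restr_source' _ _ hO, inter_eq_right]
    exact hOsrc
  refine ⟨((e ≫ₕ χ.symm).restr O).symm, ?_, hsrc.ge hyO, hsrc.le.trans hOs, fun q hq => ?_⟩
  · rw [mem_maximalAtlas_iff]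
    intro c hc
    have h1 : (e ≫ₕ χ.symm).restr O ≫ₕ c ∈ fol := by
      rw [OpenPartialHomeomorph.restr_trans, OpenPartialHomeomorph.trans_assoc]
      exact closedUnderRestriction' (fol.trans he (fol.compatible (chart_mem_atlas _ _) hc)) hO
    refine ⟨h1, ?_⟩
    have h2 := fol.symm h1
    rwa [OpenPartialHomeomorph.trans_symm_eq_symm_trans_symm] at h2
  · exact heq (hsrc.le hq)

/-- Near each point the expression of `F` in atlas charts is `Φ` composed with two changes of
charts, and membership in the pseudogroup is local. -/
theorem mem_aut_of_isLeafwiseAt {F : N ≃ₜ N} (h : ∀ m, IsLeafwiseAt F m) : F ∈ aut fol N := by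
  intro c c' hc hc'
  refine fol.locality fun x hx => ?_
  have hx1 : x ∈ c.target := hx.1
  obtain ⟨κ, hκ, κ', hκ', Φ, hΦ, hev⟩ := h (c.symm x)
  obtain ⟨O, hOsub, hO, hxO⟩ := eventually_nhds_iff.1 hev
  have hS : IsOpen (c.target ∩ c.symm ⁻¹' O) := c.symm.isOpen_inter_preimage hO
  refine ⟨_, hS, ⟨hx1, hxO⟩, ?_⟩
  have hmem : (c.symm ≫ₕ κ) ≫ₕ Φ ≫ₕ (κ'.symm ≫ₕ c') ∈ fol :=
    fol.trans (fol.compatible_of_mem_maximalAtlas (fol.subset_maximalAtlas hc) hκ)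
      (fol.trans hΦ (fol.compatible_of_mem_maximalAtlas hκ' (fol.subset_maximalAtlas hc')))
  have key : ∀ q ∈ c.target ∩ c.symm ⁻¹' O, c.symm q ∈ κ.source ∧ κ (c.symm q) ∈ Φ.source ∧
      Φ (κ (c.symm q)) ∈ κ'.target ∧ F (c.symm q) = κ'.symm (Φ (κ (c.symm q))) := by
    rintro q ⟨-, hq⟩
    obtain ⟨⟨h1, h2, h3⟩, h4⟩ := hOsub _ hq
    exact ⟨h1, h2, h3, h4⟩
  refine StructureGroupoid.restr_mem_of_eqOn hmem hS (fun q hq => (congrArg c' (key q hq).2.2.2).symm) ?_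
  rintro q ⟨hq1, hq2⟩
  obtain ⟨h1, h2, h3, h4⟩ := key q hq2
  have h5 : F (c.symm q) ∈ c'.source := hq1.2.2
  rw [h4] at h5
  exact ⟨⟨hq2.1, h1⟩, h2, h3, h5⟩

theorem isLeafwiseAt_of_eventuallyEq_id {F : N → N} {m : N} (h : ∀ᶠ q in 𝓝 m, F q = q) :
    IsLeafwiseAt F m := by
  set χ := chartAt (ℂ × ℝ) m
  have hχ := fol.chart_mem_maximalAtlas m
  refine ⟨χ, hχ, χ, hχ, _, fol.id_mem, ?_⟩
  filter_upwards [h, χ.open_source.mem_nhds (mem_chart_source _ m)] with q hq hq'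
  refine ⟨⟨hq', mem_univ _, χ.map_source hq'⟩, hq.trans (χ.left_inv hq').symm⟩

/-- A map that is conjugate, by a local isomorphism `c`, to an element of the pseudogroup. -/
theorem isLeafwiseAt_of_conj {F : N → N} {c : ℂ × ℝ → N} {s : Set (ℂ × ℝ)}
    (hc : IsLocalIsoOn c s) {p : ℂ × ℝ} (hp : s ∈ 𝓝 p)
    {Φ : OpenPartialHomeomorph (ℂ × ℝ) (ℂ × ℝ)} (hΦ : Φ ∈ fol) (hpΦ : p ∈ Φ.source)
    (hp' : s ∈ 𝓝 (Φ p)) (h : ∀ᶠ q in 𝓝 p, F (c q) = c (Φ q)) : IsLeafwiseAt F (c p) := by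
  obtain ⟨κ, hκ, hpκ, -, heq⟩ := hc.exists_chart hp
  obtain ⟨κ', hκ', hpκ', -, heq'⟩ := hc.exists_chart hp'
  refine ⟨κ, hκ, κ', hκ', Φ, hΦ, ?_⟩
  have hev : ∀ᶠ q in 𝓝 p, q ∈ Φ.source ∧ Φ q ∈ κ'.target ∧ F (c q) = c (Φ q) := by
    filter_upwards [h, Φ.open_source.mem_nhds hpΦ,
      (Φ.continuousAt hpΦ).eventually (κ'.open_target.mem_nhds hpκ')] with q h1 h2 h3
    exact ⟨h2, h3, h1⟩
  have hcp : c p = κ.symm p := heq hpκ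
  have hsrc : c p ∈ κ.source := by
    rw [hcp]
    exact κ.map_target hpκ
  have hκp : κ (c p) = p := by rw [hcp, κ.right_inv hpκ]
  have hcont := κ.continuousAt hsrc
  rw [ContinuousAt, hκp] at hcont
  filter_upwards [κ.open_source.mem_nhds hsrc, hcont.eventually hev] with m h1 h2
  obtain ⟨h3, h4, h5⟩ := h2
  refine ⟨⟨h1, h3, h4⟩, ?_⟩
  rw [heq (κ.map_source h1), κ.left_inv h1, heq' h4] at h5
  exact h5

end LocalIso

/-! ### Models of the extended automorphisms -/

theorem mem_fol_of {e : OpenPartialHomeomorph (ℂ × ℝ) (ℂ × ℝ)} (h1 : ContDiffOn ℝ ∞ e e.source)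
    (h2 : ContDiffOn ℝ ∞ e.symm e.target) (h3 : IsLeafwiseHolomorphicOn e e.source)
    (h4 : IsLeafwiseHolomorphicOn e.symm e.target) : e ∈ fol := by
  refine ⟨⟨?_, h3⟩, ⟨?_, h4⟩⟩
  · exact ContDiffOn.mono h1 inter_subset_left
  · exact ContDiffOn.mono h2 inter_subset_left

/-- The homeomorphism `(z, x) ↦ (z + β x, b x)` of `ℂ × ℝ`. -/
def shearHomeomorph {β : ℝ → ℂ} {b c : ℝ → ℝ} (hβ : Continuous β) (hb : Continuous b)
    (hc : Continuous c) (hcb : Function.LeftInverse c b) (hbc : Function.RightInverse c b) :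
    (ℂ × ℝ) ≃ₜ (ℂ × ℝ) where
  toFun p := (p.1 + β p.2, b p.2)
  invFun p := (p.1 - β (c p.2), c p.2)
  left_inv p := by simp [hcb p.2]
  right_inv p := by simp [hbc p.2]
  continuous_toFun := by fun_prop
  continuous_invFun := by fun_prop

theorem shearHomeomorph_mem_fol {β : ℝ → ℂ} {b c : ℝ → ℝ} (hβ : ContDiff ℝ ∞ β)
    (hb : ContDiff ℝ ∞ b) (hc : ContDiff ℝ ∞ c) (hcb : Function.LeftInverse c b)
    (hbc : Function.RightInverse c b) :
    (shearHomeomorph hβ.continuous hb.continuous hc.continuous hcb hbc).toOpenPartialHomeomorph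
      ∈ fol := by
  refine mem_fol_of ?_ ?_ (fun p _ => ⟨Eventually.of_forall fun _ => rfl, ?_⟩)
    (fun p _ => ⟨Eventually.of_forall fun _ => rfl, ?_⟩)
  · exact (contDiff_fst.add (hβ.comp contDiff_snd)).prodMk (hb.comp contDiff_snd) |>.contDiffOn
  · exact (contDiff_fst.sub (hβ.comp (hc.comp contDiff_snd))).prodMk (hc.comp contDiff_snd)
      |>.contDiffOn
  · exact differentiableAt_id.add_const (β p.2)
  · exact differentiableAt_id.sub_const (β (c p.2))

theorem zpow_sign_zpow_sign {s : ℤ} (hs : s = 1 ∨ s = -1) (z : ℂ) : (z ^ s) ^ s = z := by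
  rcases hs with rfl | rfl <;> simp

/-- The partial homeomorphism `(z, x) ↦ (z ^ s, x)` of `ℂ × ℝ`, for `s = 1` or `s = -1`. -/
def powHomeomorph {s : ℤ} (hs : s = 1 ∨ s = -1) : OpenPartialHomeomorph (ℂ × ℝ) (ℂ × ℝ) where
  toFun p := (p.1 ^ s, p.2)
  invFun p := (p.1 ^ s, p.2)
  source := {p | p.1 ≠ 0}
  target := {p | p.1 ≠ 0}
  map_source' _ hp := zpow_ne_zero s hp
  map_target' _ hp := zpow_ne_zero s hp
  left_inv' p _ := by simp [zpow_sign_zpow_sign hs]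
  right_inv' p _ := by simp [zpow_sign_zpow_sign hs]
  open_source := isOpen_ne_fun continuous_fst continuous_const
  open_target := isOpen_ne_fun continuous_fst continuous_const
  continuousOn_toFun := (continuousOn_fst.zpow₀ s fun _ hp => Or.inl hp).prodMk continuousOn_snd
  continuousOn_invFun := (continuousOn_fst.zpow₀ s fun _ hp => Or.inl hp).prodMk continuousOn_snd

theorem powHomeomorph_mem_fol {s : ℤ} (hs : s = 1 ∨ s = -1) : powHomeomorph hs ∈ fol := by
  have h1 : ContDiffOn ℝ ∞ (fun p : ℂ × ℝ => (p.1 ^ s, p.2)) {p | p.1 ≠ 0} := by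
    refine ContDiffOn.prodMk ?_ contDiff_snd.contDiffOn
    rcases hs with rfl | rfl
    · simpa using contDiff_fst.contDiffOn
    · simp only [zpow_neg_one]
      exact contDiff_fst.contDiffOn.inv fun p hp => hp
  have h2 : IsLeafwiseHolomorphicOn (fun p : ℂ × ℝ => (p.1 ^ s, p.2)) {p | p.1 ≠ 0} :=
    fun p hp => ⟨Eventually.of_forall fun _ => rfl, differentiableAt_id.zpow (Or.inl hp)⟩
  exact mem_fol_of h1 h1 h2 h2

/-! ### The collar of the boundary leaf -/

namespace SpiralData

variable {lam : ℂ} (S : SpiralData lam)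

theorem psi_strictMono {x : ℝ} (hx : x < 0) : StrictMono fun t => S.psi t x :=
  strictMono_of_deriv_pos fun t => S.deriv_psi_pos t x hx

theorem psi_mem {x : ℝ} (hx : x ≤ 0) (t : ℝ) : S.psi t x ≤ 0 := (S.bijOn_psi t).mapsTo hx

theorem psi_x₀_neg (t : ℝ) : S.psi t S.x₀ < 0 :=
  (S.psi_strictMono S.x₀_neg (lt_add_one t)).trans_le (S.psi_mem S.x₀_neg.le _)

theorem continuous_psi_x₀ : Continuous fun t => S.psi t S.x₀ :=
  S.contDiffOn_psi.continuousOn.comp_continuous (by fun_prop : Continuous fun t : ℝ => (t, S.x₀))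
    fun _ => ⟨mem_univ _, S.x₀_neg.le⟩

/-- The increasing sequence converges to a fixed point `l` of `psi 1`; `l < 0` is impossible because
`psi t l` strictly increases from `l` at `t = 0`. -/
theorem tendsto_psi : Tendsto (fun n : ℕ => S.psi n S.x₀) atTop (𝓝 0) := by
  have hmono : Monotone fun n : ℕ => S.psi n S.x₀ := fun m n hmn =>
    (S.psi_strictMono S.x₀_neg).monotone (by exact_mod_cast hmn)
  obtain ⟨l, hl⟩ : ∃ l, Tendsto (fun n : ℕ => S.psi n S.x₀) atTop (𝓝 l) :=
    ⟨_, tendsto_atTop_ciSup hmono ⟨0, by rintro _ ⟨n, rfl⟩; exact S.psi_mem S.x₀_neg.le _⟩⟩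
  have hl0 : l ≤ 0 := le_of_tendsto' hl fun n => S.psi_mem S.x₀_neg.le _
  rcases eq_or_lt_of_le hl0 with rfl | hl0
  · exact hl
  have hc : ContinuousOn (S.psi 1) (Iic 0) := by
    have := S.contDiffOn_psi.continuousOn.comp (f := fun x : ℝ => ((1 : ℝ), x)) (s := Iic 0)
      (by fun_prop) fun x hx => ⟨mem_univ _, hx⟩
    exact this
  have h1 : Tendsto (fun n : ℕ => S.psi (n + 1 : ℕ) S.x₀) atTop (𝓝 (S.psi 1 l)) := by
    have := (hc.continuousAt (Iic_mem_nhds hl0)).tendsto.comp hl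
    refine this.congr fun n => ?_
    push_cast
    rw [Function.comp_apply, S.psi_add_one _ _ S.x₀_neg.le]
  have h2 := tendsto_nhds_unique h1 (hl.comp (tendsto_add_atTop_nat 1))
  have h3 := S.psi_strictMono hl0 zero_lt_one
  simp only [S.psi_zero l hl0.le, h2] at h3
  exact absurd h3 (lt_irrefl _)

theorem G_add_natCast (n : ℕ) (t : ℝ) : S.G (t + n) = lam ^ n * S.G t := by
  induction n with
  | zero => simp
  | succ n ih =>
    push_cast
    rw [← add_assoc, S.G_add_one, ih, pow_succ']
    ring

/-- `‖G‖` has a positive minimum on `[0, 1]` and is multiplied by `‖lam‖` over each unit of time. -/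
theorem exists_le_norm_G (hlam : 1 < ‖lam‖) (B : ℝ) : ∃ n : ℕ, ∀ t : ℝ, n ≤ t → B ≤ ‖S.G t‖ := by
  obtain ⟨t₀, -, hmin⟩ := (isCompact_Icc (a := (0 : ℝ)) (b := 1)).exists_isMinOn
    (nonempty_Icc.2 zero_le_one) S.contDiff_G.continuous.norm.continuousOn
  have hpos : 0 < ‖S.G t₀‖ := norm_pos_iff.2 (S.G_ne_zero t₀)
  obtain ⟨n, hn⟩ := pow_unbounded_of_one_lt (B / ‖S.G t₀‖) hlam
  rw [div_lt_iff₀ hpos] at hn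
  refine ⟨n, fun t ht => ?_⟩
  have ht0 : 0 ≤ t := (Nat.cast_nonneg n).trans ht
  have h1 := S.G_add_natCast ⌊t⌋₊ (t - ⌊t⌋₊)
  rw [sub_add_cancel] at h1
  rw [h1, norm_mul, norm_pow]
  have h2 : ‖S.G t₀‖ ≤ ‖S.G (t - ⌊t⌋₊)‖ :=
    hmin ⟨sub_nonneg.2 (Nat.floor_le ht0), by linarith [Nat.lt_floor_add_one t]⟩
  have h3 : ‖lam‖ ^ n ≤ ‖lam‖ ^ ⌊t⌋₊ := pow_le_pow_right₀ hlam.le (Nat.le_floor ht)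
  calc B ≤ ‖lam‖ ^ n * ‖S.G t₀‖ := hn.le
    _ ≤ _ := by gcongr

theorem collar_mem_nhds (hlam : 1 < ‖lam‖) {z : ℂ} (hz : z ≠ 0) : S.collar ∈ 𝓝 (z, (0 : ℝ)) := by
  -- For `x < 0` close to `0`, the time `t` with `psi t x₀ = x` is at least `n`, so `‖G t‖` exceeds
  -- the norm of every first coordinate near `z`, and `w = z / G t` lies in the unit disc.
  obtain ⟨n, hn⟩ := S.exists_le_norm_G hlam (‖z‖ + 1)
  have h1 : ∀ᶠ p : ℂ × ℝ in 𝓝 (z, 0), p.1 ≠ 0 :=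
    continuous_fst.continuousAt.eventually (isOpen_compl_singleton.mem_nhds hz)
  have h2 : ∀ᶠ p : ℂ × ℝ in 𝓝 (z, 0), ‖p.1‖ < ‖z‖ + 1 :=
    continuous_fst.norm.continuousAt.eventually (Iio_mem_nhds (lt_add_one ‖z‖))
  have h3 : ∀ᶠ p : ℂ × ℝ in 𝓝 (z, 0), S.psi n S.x₀ < p.2 :=
    continuous_snd.continuousAt.eventually (Ioi_mem_nhds (S.psi_x₀_neg n))
  filter_upwards [h1, h2, h3] with p hp1 hp2 hp3
  refine ⟨hp1, fun hp => ?_⟩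
  obtain ⟨m, hm, hnm⟩ := ((S.tendsto_psi.eventually (Ioi_mem_nhds hp)).and
    (eventually_ge_atTop n)).exists
  obtain ⟨t, ht, hpt⟩ := intermediate_value_Icc (show (n : ℝ) ≤ m by exact_mod_cast hnm)
    S.continuous_psi_x₀.continuousOn ⟨hp3.le, (le_of_lt hm : p.2 ≤ S.psi m S.x₀)⟩
  refine ⟨p.1 / S.G t, t, ?_, Prod.ext ?_ hpt.symm⟩
  · rw [norm_div, div_lt_one (norm_pos_iff.2 (S.G_ne_zero t))]
    exact hp2.trans_le (hn t ht.1)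
  · exact (mul_div_cancel₀ _ (S.G_ne_zero t)).symm

end SpiralData

theorem TransversalTube.isClosed_core {M : Type*} [TopologicalSpace M] [T2Space M]
    [ChartedSpace (ℂ × ℝ) M] (U : TransversalTube M) : IsClosed U.core := by
  have hc : Continuous fun t : ℝ => U.toFun (0, t) :=
    U.isLocalIsoOn.continuousOn.comp_continuous (by fun_prop) fun t => by simp
  have h : U.core = (fun t : ℝ => U.toFun (0, t)) '' Icc 0 1 := by
    ext m
    constructor
    · rintro ⟨t, rfl⟩
      refine ⟨Int.fract t, ⟨Int.fract_nonneg t, (Int.fract_lt_one t).le⟩, ?_⟩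
      exact (U.eq_iff 0 0 _ _ (by simp) (by simp)).2 ⟨rfl, ⌊t⌋, (Int.fract_add_floor t).symm⟩
    · rintro ⟨t, -, rfl⟩
      exact ⟨t, rfl⟩
  rw [h]
  exact (isCompact_Icc.image hc).isClosed

/-! ### Extending automorphisms of the new Reeb component by the identity -/

namespace Turbulization

variable {M₀ M₁ : Type*} [TopologicalSpace M₀] [ChartedSpace (ℂ × ℝ) M₀]
  [TopologicalSpace M₁] [ChartedSpace (ℂ × ℝ) M₁] {D : HopfData} (𝒯 : Turbulization M₀ M₁ D)

open Classical in
/-- Extension by the identity of the permutations of the new Reeb component. -/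
def extendHom : Equiv.Perm D.Reeb →* Equiv.Perm M₁ :=
  Equiv.Perm.extendDomainHom (Equiv.ofInjective 𝒯.reeb 𝒯.injective_reeb)

theorem extendHom_reeb (g : Equiv.Perm D.Reeb) (y : D.Reeb) :
    𝒯.extendHom g (𝒯.reeb y) = 𝒯.reeb (g y) := by
  classical
  exact Equiv.Perm.extendDomain_apply_image g (Equiv.ofInjective 𝒯.reeb 𝒯.injective_reeb) y

theorem extendHom_of_notMem (g : Equiv.Perm D.Reeb) {m : M₁} (hm : m ∉ range 𝒯.reeb) :
    𝒯.extendHom g m = m := by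
  classical
  exact Equiv.Perm.extendDomain_apply_not_subtype g _ hm

/-- The complement is the image of the open set `M₀ ∖ K` under a local isomorphism, `K` being
compact in a Hausdorff space. So the extension is locally the identity outside the Reeb component.
-/
theorem isClosed_range_reeb [T2Space M₀] : IsClosed (range 𝒯.reeb) := by
  rw [𝒯.range_reeb]
  exact (𝒯.isLocalIsoOn_outer.isOpen_image 𝒯.tube.isClosed_core.isOpen_compl).isClosed_compl

theorem collarMap_notMem_range {p : ℂ × ℝ} (hp : p ∈ 𝒯.spiral.collar) (hneg : p.2 < 0) :
    𝒯.collarMap p ∉ range 𝒯.reeb := by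
  obtain ⟨w, t, hw, hpw⟩ := hp.2 hneg
  have hw0 : w ≠ 0 := by
    rintro rfl
    exact hp.1 (by rw [hpw, mul_zero])
  rw [hpw, 𝒯.collarMap_neg w t hw0 hw, 𝒯.range_reeb, mem_compl_iff, not_not]
  refine mem_image_of_mem _ ?_
  rintro ⟨t', ht'⟩
  exact hw0 ((𝒯.tube.eq_iff w 0 t t' hw (by simp)).1 ht').1

variable [T2Space M₀] [HasGroupoid M₁ fol]

theorem isLeafwiseAt_extendHom (hD : D.IsFlat) {g : D.Reeb ≃ₜ D.Reeb} (hg : g ∈ D.autRel)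
    (m : M₁) : IsLeafwiseAt (𝒯.extendHom g.toEquiv) m := by
  by_cases hm : m ∈ range 𝒯.reeb
  swap
  · refine isLeafwiseAt_of_eventuallyEq_id ?_
    filter_upwards [𝒯.isClosed_range_reeb.isOpen_compl.mem_nhds hm] with q hq
    exact 𝒯.extendHom_of_notMem _ hq
  obtain ⟨y, rfl⟩ := hm
  obtain ⟨⟨⟨z, x⟩, hzx⟩, rfl⟩ : ∃ p, D.proj p = y := Quotient.exists_rep y
  rw [← HopfData.point_eq hzx]
  obtain ⟨β, b, c, hβ, hb, hc, hcb, hbc, hβ0, hb0, hbpos, hform⟩ := hD.exists_normal_form hg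
  set Φ := shearHomeomorph hβ.continuous hb.continuous hc.continuous hcb hbc with hΦ
  have hΦmem : Φ.toOpenPartialHomeomorph ∈ fol := shearHomeomorph_mem_fol hβ hb hc hcb hbc
  rcases eq_or_ne x 0 with rfl | hx
  · have hz : z ≠ 0 := fun h => hzx (by rw [h])
    have hz' : z ^ 𝒯.sign ≠ 0 := zpow_ne_zero _ hz
    have hpt : 𝒯.reeb (D.point z (0 : ℝ≥0)) = 𝒯.collarMap (z ^ 𝒯.sign, 0) := by
      rw [𝒯.collarMap_nonneg _ _ hz' le_rfl, zpow_sign_zpow_sign 𝒯.sign_eq, NNReal.coe_zero]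
    rw [hpt]
    -- `σ` is an involution passing between the collar coordinate and the coordinate `z ^ sign` of
    -- the Reeb component. The extension reads as `σ ≫ₕ Φ ≫ₕ σ` in the collar, which is the identity
    -- for `x ≤ 0`.
    set σ := powHomeomorph 𝒯.sign_eq
    have hσ : σ ∈ fol := powHomeomorph_mem_fol 𝒯.sign_eq
    have hval : ∀ q : ℂ × ℝ, q.2 ≤ 0 → (σ ≫ₕ Φ.toOpenPartialHomeomorph ≫ₕ σ) q = q := by
      intro q hq
      change ((q.1 ^ 𝒯.sign + β q.2) ^ 𝒯.sign, b q.2) = q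
      rw [hβ0 _ hq, hb0 _ hq, add_zero, zpow_sign_zpow_sign 𝒯.sign_eq]
    have hsrc : (z ^ 𝒯.sign, (0 : ℝ)) ∈ (σ ≫ₕ Φ.toOpenPartialHomeomorph ≫ₕ σ).source := by
      refine ⟨hz', mem_univ _, ?_⟩
      change (z ^ 𝒯.sign) ^ 𝒯.sign + β 0 ≠ 0
      rwa [hβ0 0 le_rfl, add_zero, zpow_sign_zpow_sign 𝒯.sign_eq]
    have hcollar := 𝒯.spiral.collar_mem_nhds D.one_lt_norm_lam hz'
    refine isLeafwiseAt_of_conj 𝒯.isLocalIsoOn_collarMap hcollar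
      (fol.trans hσ (fol.trans hΦmem hσ)) hsrc ?_ ?_
    · rwa [hval _ le_rfl]
    · filter_upwards [hcollar, (σ ≫ₕ Φ.toOpenPartialHomeomorph ≫ₕ σ).open_source.mem_nhds hsrc]
        with q hq hqs
      rcases lt_or_ge q.2 0 with hneg | hpos
      · rw [hval q hneg.le, 𝒯.extendHom_of_notMem _ (𝒯.collarMap_notMem_range hq hneg)]
      · obtain ⟨w, t⟩ := q
        have hw : w ≠ 0 := hqs.1
        have hw' : w ^ 𝒯.sign + β t ≠ 0 := hqs.2.2
        have hbt : 0 ≤ b t := by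
          rcases eq_or_lt_of_le hpos with h | h
          · rw [hb0 t h.ge]
            exact hpos
          · exact (hbpos t h).le
        change _ = 𝒯.collarMap ((w ^ 𝒯.sign + β t) ^ 𝒯.sign, b t)
        rw [𝒯.collarMap_nonneg _ _ hw hpos, 𝒯.collarMap_nonneg _ _ (zpow_ne_zero _ hw') hbt,
          zpow_sign_zpow_sign 𝒯.sign_eq, extendHom_reeb]
        exact congrArg 𝒯.reeb (hform _ _ hpos (Or.inl (zpow_ne_zero _ hw)))
  · have hopen : IsOpen {p : ℂ × ℝ | 0 < p.2} := isOpen_lt continuous_const continuous_snd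
    have hx' : 0 < (x : ℝ) := NNReal.coe_pos.2 (pos_iff_ne_zero.2 hx)
    refine isLeafwiseAt_of_conj (p := (z, (x : ℝ))) 𝒯.isLocalIsoOn_reeb (hopen.mem_nhds hx') hΦmem
      (mem_univ _) (hopen.mem_nhds (hbpos _ hx')) ?_
    filter_upwards [hopen.mem_nhds hx'] with q hq
    rw [extendHom_reeb]
    exact congrArg 𝒯.reeb (hform _ _ (le_of_lt hq) (Or.inr hq))

/-- Extension by the identity of the automorphisms of the new Reeb component that are the identity
on its boundary leaf. -/
def extendAut (hD : D.IsFlat) : D.autRel →* aut fol M₁ where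
  toFun g := ⟨⟨𝒯.extendHom g.1.toEquiv,
    continuous_iff_continuousAt.2 fun m =>
      (𝒯.isLeafwiseAt_extendHom hD g.2 m).continuousAt,
    -- The inverse of the extension is the extension of the inverse.
    continuous_iff_continuousAt.2 fun m =>
      (𝒯.isLeafwiseAt_extendHom hD (D.autRel.inv_mem g.2) m).continuousAt⟩,
    mem_aut_of_isLeafwiseAt (𝒯.isLeafwiseAt_extendHom hD g.2)⟩
  map_one' := Subtype.ext <| Homeomorph.ext fun m =>
    Equiv.congr_fun 𝒯.extendHom.map_one m
  map_mul' g g' := Subtype.ext <| Homeomorph.ext fun m =>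
    Equiv.congr_fun (𝒯.extendHom.map_mul g.1.toEquiv g'.1.toEquiv) m

end Turbulization

/-! ### Invariance of the boundary leaf -/

theorem snd_eq_of_isLeafwiseHolomorphicOn {X : Type*} {f : ℂ × X → ℂ × X} {s : Set (ℂ × X)}
    (hf : IsLeafwiseHolomorphicOn f s) {B : Set ℂ} (hB : IsPreconnected B) {x : X}
    (hBs : ∀ z ∈ B, (z, x) ∈ s) {z z' : ℂ} (hz : z ∈ B) (hz' : z' ∈ B) :
    (f (z, x)).2 = (f (z', x)).2 := by
  have : PreconnectedSpace B := isPreconnected_iff_preconnectedSpace.1 hB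
  have hloc : IsLocallyConstant fun u : B => (f (u.1, x)).2 :=
    (IsLocallyConstant.iff_eventually_eq _).2 fun u =>
      continuous_subtype_val.continuousAt.eventually (hf _ (hBs u.1 u.2)).1
  exact hloc.apply_eq_of_preconnectedSpace ⟨z, hz⟩ ⟨z', hz'⟩

/-- If a boundary point went to positive height, the height of `e.symm` along a vertical segment
through the image would be continuous and, since `e` maps plaques into plaques, injective. It would
then be strictly monotone, yet it attains its least value `0` at an interior point. -/
theorem snd_eq_zero_of_mem_folBdry {e : OpenPartialHomeomorph (ℂ × ℝ≥0) (ℂ × ℝ≥0)}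
    (he : e ∈ folBdry) {p : ℂ × ℝ≥0} (hp : p ∈ e.source) (hp0 : p.2 = 0) : (e p).2 = 0 := by
  by_contra hne
  have hpos : 0 < (e p).2 := pos_iff_ne_zero.2 hne
  obtain ⟨U, hU, V, hV, hUV⟩ := mem_nhds_prod_iff.1 (e.open_source.mem_nhds hp)
  obtain ⟨r, hr, hrU⟩ := Metric.mem_nhds_iff.1 hU
  have hc : ContinuousAt (fun s : ℝ≥0 => ((e p).1, s)) (e p).2 := by fun_prop
  have htgt : ∀ᶠ s in 𝓝 (e p).2, ((e p).1, s) ∈ e.target :=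
    hc.eventually (e.open_target.mem_nhds (e.map_source hp))
  have hsymm : ∀ᶠ s in 𝓝 (e p).2, e.symm ((e p).1, s) ∈ Metric.ball p.1 r ×ˢ V := by
    have h1 := (e.continuousAt_symm (e.map_source hp)).tendsto
    rw [e.left_inv hp] at h1
    exact (h1.comp hc).eventually (prod_mem_nhds (Metric.ball_mem_nhds _ hr) hV)
  obtain ⟨a, b, ⟨ha, hb⟩, hab⟩ := (mem_nhds_iff_exists_Ioo_subset' ⟨0, hpos⟩
    ⟨_, lt_add_one (e p).2⟩).1 (htgt.and hsymm)
  obtain ⟨a', ha1, ha2⟩ := exists_between ha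
  obtain ⟨b', hb1, hb2⟩ := exists_between hb
  have hsub : ∀ s ∈ Icc a' b', ((e p).1, s) ∈ e.target ∧
      e.symm ((e p).1, s) ∈ Metric.ball p.1 r ×ˢ V := fun s hs =>
    hab ⟨ha1.trans_le hs.1, hs.2.trans_lt hb2⟩
  have hcont : ContinuousOn (fun s => (e.symm ((e p).1, s)).2) (Icc a' b') :=
    continuous_snd.comp_continuousOn (e.continuousOn_symm.comp (by fun_prop)
      fun s hs => (hsub s hs).1)
  -- Two preimages of equal height lie in one plaque, over a ball, so `e` sends them to the same
  -- height.
  have hinj : InjOn (fun s => (e.symm ((e p).1, s)).2) (Icc a' b') := by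
    intro s hs t ht hst
    obtain ⟨hs1, hs2, hs3⟩ := hsub s hs
    obtain ⟨ht1, ht2, -⟩ := hsub t ht
    have h1 := snd_eq_of_isLeafwiseHolomorphicOn he.1.2 (convex_ball p.1 r).isPreconnected
      (fun z hz => hUV ⟨hrU hz, hs3⟩) hs2 ht2
    have h2 : ((e.symm ((e p).1, t)).1, (e.symm ((e p).1, s)).2) = e.symm ((e p).1, t) :=
      Prod.ext rfl hst
    rw [h2, Prod.mk.eta, e.right_inv hs1, e.right_inv ht1] at h1
    exact h1
  have h0 : (e.symm ((e p).1, (e p).2)).2 = 0 := by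
    rw [Prod.mk.eta, e.left_inv hp, hp0]
  have hmem : (e p).2 ∈ Icc a' b' := ⟨ha2.le, hb1.le⟩
  rcases hcont.strictMonoOn_of_injOn_Icc' (ha2.trans hb1).le hinj with h | h
  · have := h ⟨le_rfl, (ha2.trans hb1).le⟩ hmem ha2
    simp only [h0] at this
    exact not_lt_zero this
  · have := h hmem ⟨(ha2.trans hb1).le, le_rfl⟩ hb1
    simp only [h0] at this
    exact not_lt_zero this

namespace HopfData

variable {D D' : HopfData}

theorem map_mem_boundaryLeaf (h : Structomorph folBdry D.Reeb D'.Reeb) {y : D.Reeb}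
    (hy : y ∈ D.boundaryLeaf) : h.toHomeomorph y ∈ D'.boundaryLeaf := by
  obtain ⟨p, hp0, rfl⟩ := hy
  obtain ⟨e, he, hpe⟩ := D.exists_chart_target p
  obtain ⟨e', he', hye'⟩ := D'.exists_chart (h.toHomeomorph (D.proj p))
  obtain ⟨_, hep⟩ := he _ hpe
  have hval : h.toHomeomorph (e.symm p.1) = h.toHomeomorph (D.proj p) := congrArg _ hep
  have hsrc : p.1 ∈ (e.symm ≫ₕ h.toHomeomorph.toOpenPartialHomeomorph ≫ₕ e').source := by
    refine ⟨hpe, mem_univ _, ?_⟩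
    change h.toHomeomorph (e.symm p.1) ∈ e'.source
    rwa [hval]
  have h0 := snd_eq_zero_of_mem_folBdry (h.mem_groupoid e e' he he') hsrc hp0
  change (e' (h.toHomeomorph (e.symm p.1))).2 = 0 at h0
  rw [hval] at h0
  obtain ⟨hq, heq⟩ := he' _ (e'.map_source hye')
  rw [e'.left_inv hye'] at heq
  rw [heq]
  exact ⟨_, h0, rfl⟩

/-- Conjugation by an isomorphism of Reeb components. -/
def conjAut (h : Structomorph folBdry D.Reeb D'.Reeb) : D.autRel →* D'.autRel where
  toFun f := ⟨(h.toHomeomorph.symm.trans f.1).trans h.toHomeomorph,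
    ((h.symm.trans (⟨f.1, f.2.1⟩ : Structomorph folBdry D.Reeb D.Reeb)).trans h).mem_groupoid,
    fun y hy => by
      have h1 : f.1 (h.toHomeomorph.symm y) = h.toHomeomorph.symm y :=
        f.2.2 _ (map_mem_boundaryLeaf h.symm hy)
      exact (congrArg h.toHomeomorph h1).trans (h.toHomeomorph.apply_symm_apply y)⟩
  map_one' := Subtype.ext <| Homeomorph.ext fun y => h.toHomeomorph.apply_symm_apply y
  map_mul' f f' := Subtype.ext <| Homeomorph.ext fun y => by
    change _ = h.toHomeomorph (f.1 (h.toHomeomorph.symm (h.toHomeomorph _)))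
    rw [Homeomorph.symm_apply_apply]
    rfl

theorem conjAut_apply (h : Structomorph folBdry D.Reeb D'.Reeb) (f : D.autRel) (y : D.Reeb) :
    (conjAut h f).1 (h.toHomeomorph y) = h.toHomeomorph (f.1 y) :=
  congrArg (fun y => h.toHomeomorph (f.1 y)) (h.toHomeomorph.symm_apply_apply y)

end HopfData

end LeafwiseComplex

end
/-- Let `M₁` be obtained from `M₀` by turbulization along a closed transversal, let the resulting
Reeb component, whose holonomy is infinitely tangent to the identity, be isomorphic by `h` to
`R = R_{phi, lam}`.  Then `Aut (R, H)` is isomorphic to a subgroup of `Aut M₁`, by extending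
automorphisms by the identity. -/
theorem theorem4p2 {M₀ M₁ : Type*}
    [TopologicalSpace M₀] [T2Space M₀] [ChartedSpace (ℂ × ℝ) M₀]
    [HasGroupoid M₀ LeafwiseComplex.fol]
    [TopologicalSpace M₁] [T2Space M₁] [ChartedSpace (ℂ × ℝ) M₁]
    [HasGroupoid M₁ LeafwiseComplex.fol]
    (D D' : LeafwiseComplex.HopfData) (𝒯 : LeafwiseComplex.Turbulization M₀ M₁ D')
    (hflat : D'.IsFlat)
    (h : Structomorph LeafwiseComplex.folBdry D.Reeb D'.Reeb) :
    ∃ (A : Subgroup (LeafwiseComplex.aut LeafwiseComplex.fol M₁)) (Θ : D.autRel ≃* A),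
      ∀ f : D.autRel,
        (∀ y : D.Reeb, ((Θ f : LeafwiseComplex.aut LeafwiseComplex.fol M₁) : M₁ ≃ₜ M₁)
          (𝒯.reeb (h.toHomeomorph y)) = 𝒯.reeb (h.toHomeomorph ((f : D.Reeb ≃ₜ D.Reeb) y))) ∧
        (∀ m ∉ range 𝒯.reeb,
          ((Θ f : LeafwiseComplex.aut LeafwiseComplex.fol M₁) : M₁ ≃ₜ M₁) m = m) := by
  have hreeb : ∀ (f : D.autRel) (y : D.Reeb),
      (𝒯.extendAut hflat (LeafwiseComplex.HopfData.conjAut h f) : M₁ ≃ₜ M₁)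
        (𝒯.reeb (h.toHomeomorph y)) = 𝒯.reeb (h.toHomeomorph ((f : D.Reeb ≃ₜ D.Reeb) y)) :=
    fun f y => (𝒯.extendHom_reeb _ _).trans
      (congrArg 𝒯.reeb (LeafwiseComplex.HopfData.conjAut_apply h f y))
  have hinj : Function.Injective
      ((𝒯.extendAut hflat).comp (LeafwiseComplex.HopfData.conjAut h)) := by
    intro f f' hff'
    refine Subtype.ext (Homeomorph.ext fun y => ?_)
    refine h.toHomeomorph.injective (𝒯.injective_reeb ?_)
    rw [← hreeb, ← hreeb]
    exact congrArg (fun F : LeafwiseComplex.aut LeafwiseComplex.fol M₁ =>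
      (F : M₁ ≃ₜ M₁) (𝒯.reeb (h.toHomeomorph y))) hff'
  -- The subgroup is the range of the injective homomorphism.
  exact ⟨_, MonoidHom.ofInjective hinj, fun f => ⟨hreeb f,
    fun m hm => 𝒯.extendHom_of_notMem _ hm⟩⟩
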